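/- A quantale is a complete lattice $Q$ with an associative multiplication $*$ that preserves arbitrary joins in each variable; homomorphisms of quantales preserve arbitrary joins and $*$, and they form the category $\mathbf{Quant}$. A homomorphism is strong if it preserves the top element $\top$. A quantale is balanced if $\top*\top=\top$, bisymmetric if $a*b*c*d=a*c*b*d$ for all $a,b,c,d$, and semi-unital if $a\le\top*a$ and $a\le a*\top$ for all $a$; $\mathbf{BSQuant}$ is the category of balanced bisymmetric quantales and strong homomorphisms. An element $a$ is left-sided if $\top*a\le a$, right-sided if $a*\top\le a$, and two-sided if both hold; $\mathbb L(Q)$, $\mathbb R(Q)$, $\mathbb I(Q)$ denote the corresponding subquantales of $Q$. An involution on $Q$ is a join-preserving map $a\mapsto a'$ with $(a*b)'=b'*a'$ and $a''=a$. A quantic frame is a bisymmetric, semi-unital quantale $Q$ with an involution such that (A) every left-sided and every right-sided element is idempotent; (B) $a'=a$ for every two-sided $a$; (C) the square of inclusions $\mathbb I(Q)\hookrightarrow\mathbb L(Q)\hookrightarrow Q$, $\mathbb I(Q)\hookrightarrow\mathbb R(Q)\hookrightarrow Q$ is a pushout in $\mathbf{BSQuant}$. Let $A$ be a unital $C^*$-algebra,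 and let $\mathbb L(A)$, $\mathbb R(A)$, $\mathbb I(A)$ be the quantales of closed left, closed right and closed two-sided ideals of $A$, ordered by inclusion, where the product of two ideals is the closed linear span of the products of their elements. Let $\mathbb L(A)\otimes\mathbb R(A)$ be the tensor product of complete lattices with the multiplication determined by $(M_1\otimes N_1)*(M_2\otimes N_2)=(M_1*M_2)\otimes(N_1*N_2)$ and the involution determined by $(M\otimes N)'=N^*\otimes M^*$, where $M^*=\{a^*: a\in M\}$. Let $\mathbb L(A)\otimes\mathbb R(A)\xrightarrow{\pi}\Omega_q(A)$ be the quotient by the pointwise meet of all nuclei $c$ on $\mathbb L(A)\otimes\mathbb R(A)$ (closure operators with $c(x)*c(y)\le c(x*y)$) that satisfy $c(I\otimes\top)=c(\top\otimes I)$ for all $I\in\mathbb I(A)$. Then: 1. $\pi$ is the coequalizer in $\mathbf{Quant}$ of the two homomorphisms $\mathbb I(A)\rightrightarrows\mathbb L(A)\otimes\mathbb R(A)$, $I\mapsto I\otimes\top$ and $I\mapsto\top\otimes I$. 2. There is an involution on $\Omega_q(A)$ with $\pi(t')=\pi(t)'$ for all $t$, and with it $\Omega_q(A)$ is a quantic frame.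 The quantale $\mathbb I(\Omega_q(A))$ is commutative. 3. The map $M\mapsto\pi(M\otimes\top)$ is an isomorphism of quantales from $\mathbb L(A)$ onto $\mathbb L(\Omega_q(A))$. 4. If $A$ is commutative, then the involution of $\Omega_q(A)$ is the identity, $\mathbb I(A)$ is a frame, and there is an isomorphism of quantales $\Omega_q(A)\cong\mathbb I(A)$ that sends $\pi(I\otimes J)$ to $I*J$ and turns the multiplication of $\Omega_q(A)$ into the binary meet of $\mathbb I(A)$. -/

import Mathlib

universe u

noncomputable section

namespace QuanticSpectrum

open CategoryTheory

/-! ## Quantales: Mathlib's mixin `IsQuantale` over `Semigroup` and `CompleteLattice` -/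

section Basic

/-- Quantale homomorphisms: maps that preserve arbitrary joins and the multiplication. -/
@[ext]
structure QuantaleHom (Q R : Type u) [CompleteLattice Q] [Semigroup Q] [CompleteLattice R]
    [Semigroup R] extends sSupHom Q R where
  map_mul' : ∀ a b, toFun (a * b) = toFun a * toFun b

instance (Q R : Type u) [CompleteLattice Q] [Semigroup Q] [CompleteLattice R] [Semigroup R] :
    CoeFun (QuantaleHom Q R) (fun _ => Q → R) := ⟨fun f => f.toFun⟩

/-- An involution on a quantale: a join-preserving anti-homomorphism that is its own inverse. -/
structure Involution (Q : Type u) [CompleteLattice Q] [Semigroup Q] extends sSupHom Q Q where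
  map_mul' : ∀ a b, toFun (a * b) = toFun b * toFun a
  involutive' : ∀ a, toFun (toFun a) = a

instance (Q : Type u) [CompleteLattice Q] [Semigroup Q] :
    CoeFun (Involution Q) (fun _ => Q → Q) := ⟨fun f => f.toFun⟩

variable (Q : Type u) [CompleteLattice Q] [Semigroup Q]

def IsBalanced : Prop := (⊤ : Q) * ⊤ = ⊤

def IsBisymmetric : Prop := ∀ a b c d : Q, a * b * c * d = a * c * b * d

def IsSemiUnital : Prop := ∀ a : Q, a ≤ ⊤ * a ∧ a ≤ a * ⊤

variable {Q}

def IsLeftSided (a : Q) : Prop := ⊤ * a ≤ a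

def IsRightSided (a : Q) : Prop := a * ⊤ ≤ a

theorem IsSemiUnital.isBalanced (h : IsSemiUnital Q) : IsBalanced Q :=
  le_antisymm le_top (h ⊤).1

end Basic

/-! ## Subquantales -/

/-- A subquantale: a subset closed under arbitrary joins and multiplication. -/
structure Subquantale (Q : Type u) [CompleteLattice Q] [Semigroup Q] where
  carrier : Set Q
  sSup_mem' : ∀ s ⊆ carrier, sSup s ∈ carrier
  mul_mem' : ∀ a ∈ carrier, ∀ b ∈ carrier, a * b ∈ carrier

namespace Subquantale

variable {Q : Type u} [CompleteLattice Q] [Semigroup Q]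

/-- The elements of a subquantale, as a type. -/
@[ext]
structure Elem (S : Subquantale Q) : Type u where
  val : Q
  property : val ∈ S.carrier

instance : CoeSort (Subquantale Q) (Type u) := ⟨Elem⟩

variable (S : Subquantale Q)

instance : PartialOrder S := PartialOrder.lift Elem.val fun _ _ => Elem.ext

instance : SupSet S :=
  ⟨fun s => ⟨sSup (Elem.val '' s), S.sSup_mem' _ (by rintro _ ⟨x, -, rfl⟩; exact x.2)⟩⟩

/-- The order is the induced one, and joins are computed in the ambient quantale. -/
instance : CompleteLattice S :=
  completeLatticeOfSup S fun _ =>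
    ⟨fun _ hx => le_sSup (Set.mem_image_of_mem Elem.val hx),
     fun _ hy => sSup_le (by rintro _ ⟨x, hx, rfl⟩; exact hy hx)⟩

instance : Semigroup S where
  mul a b := ⟨a.1 * b.1, S.mul_mem' _ a.2 _ b.2⟩
  mul_assoc a b c := Elem.ext (mul_assoc a.1 b.1 c.1)

variable {S} in
theorem coe_le {a b : S} : a ≤ b ↔ a.1 ≤ b.1 := Iff.rfl

theorem coe_sSup (s : Set S) : (sSup s : S).1 = sSup (Elem.val '' s) := rfl

theorem coe_mul (a b : S) : (a * b).1 = a.1 * b.1 := rfl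

theorem coe_iSup₂ (s : Set S) (f : S → S) : (⨆ y ∈ s, f y).1 = ⨆ y ∈ s, (f y).1 := by
  rw [← sSup_image, coe_sSup, Set.image_image, sSup_image]

instance [IsQuantale Q] : IsQuantale S where
  mul_sSup_distrib a s := Elem.ext (by
    rw [coe_iSup₂, coe_mul, coe_sSup, mul_sSup_distrib, iSup_image]; rfl)
  sSup_mul_distrib s b := Elem.ext (by
    rw [coe_iSup₂, coe_mul, coe_sSup, sSup_mul_distrib, iSup_image]; rfl)

/-- The inclusion of a subquantale into the ambient quantale. -/
def incl : QuantaleHom S Q where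
  toFun := Elem.val
  map_sSup' _ := rfl
  map_mul' _ _ := rfl

/-- The inclusion of a subquantale into a larger one. -/
def inclusion {S T : Subquantale Q} (h : S.carrier ⊆ T.carrier) : QuantaleHom S T where
  toFun a := ⟨a.1, h a.2⟩
  map_sSup' s := Elem.ext (by
    rw [coe_sSup, coe_sSup, Set.image_image])
  map_mul' _ _ := rfl

theorem coe_top_of_mem (h : (⊤ : Q) ∈ S.carrier) : (⊤ : S).1 = ⊤ :=
  top_le_iff.mp (coe_le.mp (le_top : (⟨⊤, h⟩ : S) ≤ ⊤))

end Subquantale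

section Sided

variable (Q : Type u) [CompleteLattice Q] [Semigroup Q] [IsQuantale Q]

/-- The subquantale of left-sided elements. -/
def leftPart : Subquantale Q where
  carrier := {a | IsLeftSided a}
  sSup_mem' s hs := by
    change ⊤ * sSup s ≤ sSup s
    rw [mul_sSup_distrib]
    exact iSup₂_le fun y hy => (hs hy).trans (le_sSup hy)
  mul_mem' a ha b _ := by
    change ⊤ * (a * b) ≤ a * b
    rw [← mul_assoc]
    exact mul_le_mul_left ha b

/-- The subquantale of right-sided elements. -/
def rightPart : Subquantale Q where
  carrier := {a | IsRightSided a}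
  sSup_mem' s hs := by
    change sSup s * ⊤ ≤ sSup s
    rw [sSup_mul_distrib]
    exact iSup₂_le fun y hy => (hs hy).trans (le_sSup hy)
  mul_mem' a _ b hb := by
    change a * b * ⊤ ≤ a * b
    rw [mul_assoc]
    exact mul_le_mul_right hb a

/-- The subquantale of two-sided elements. -/
def twoSidedPart : Subquantale Q where
  carrier := {a | IsLeftSided a ∧ IsRightSided a}
  sSup_mem' s hs := ⟨(leftPart Q).sSup_mem' s fun _ h => (hs h).1,
    (rightPart Q).sSup_mem' s fun _ h => (hs h).2⟩
  mul_mem' a ha b hb := ⟨(leftPart Q).mul_mem' a ha.1 b hb.1,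
    (rightPart Q).mul_mem' a ha.2 b hb.2⟩

end Sided

/-! ## The categories of quantales and of balanced bisymmetric quantales -/

section Categories

/-- Strong quantale homomorphisms: those that preserve the top element. -/
@[ext]
structure StrongHom (Q R : Type u) [CompleteLattice Q] [Semigroup Q] [CompleteLattice R]
    [Semigroup R] extends QuantaleHom Q R where
  map_top' : toFun ⊤ = ⊤

/-- The objects of the category of quantales. -/
structure Quant : Type (u + 1) where
  carrier : Type u
  [lattice : CompleteLattice carrier]
  [semigroup : Semigroup carrier]
  [quantale : IsQuantale carrier]

attribute [instance] Quant.lattice Quant.semigroup Quant.quantale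

instance : Category Quant.{u} where
  Hom Q R := QuantaleHom Q.carrier R.carrier
  id Q := { toFun := fun a => a, map_sSup' := fun s => by simp, map_mul' := fun _ _ => rfl }
  comp f g :=
    { toFun := fun a => g (f a)
      map_sSup' := fun s => by rw [f.map_sSup', g.map_sSup', Set.image_image]
      map_mul' := fun a b => by rw [f.map_mul', g.map_mul'] }

/-- A quantale as an object of `Quant`. -/
def Quant.of (Q : Type u) [CompleteLattice Q] [Semigroup Q] [IsQuantale Q] : Quant.{u} := ⟨Q⟩

/-- The objects of the category of balanced and bisymmetric quantales. -/
structure BSQuant : Type (u + 1) where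
  carrier : Type u
  [lattice : CompleteLattice carrier]
  [semigroup : Semigroup carrier]
  [quantale : IsQuantale carrier]
  balanced : IsBalanced carrier
  bisymmetric : IsBisymmetric carrier

attribute [instance] BSQuant.lattice BSQuant.semigroup BSQuant.quantale

/-- The morphisms are the strong quantale homomorphisms. -/
instance : Category BSQuant.{u} where
  Hom Q R := StrongHom Q.carrier R.carrier
  id Q :=
    { toFun := fun a => a, map_sSup' := fun s => by simp, map_mul' := fun _ _ => rfl
      map_top' := rfl }
  comp f g :=
    { toFun := fun a => g.toFun (f.toFun a)
      map_sSup' := fun s => by rw [f.map_sSup', g.map_sSup', Set.image_image]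
      map_mul' := fun a b => by rw [f.map_mul', g.map_mul']
      map_top' := by rw [f.map_top', g.map_top'] }

end Categories

/-! ## Quantic frames -/

section QuanticFrame

variable (Q : Type u) [CompleteLattice Q] [Semigroup Q] [IsQuantale Q]

theorem coe_top_leftPart : (⊤ : leftPart Q).1 = ⊤ :=
  Subquantale.coe_top_of_mem _ (show (⊤ : Q) * ⊤ ≤ ⊤ from le_top)

theorem coe_top_rightPart : (⊤ : rightPart Q).1 = ⊤ :=
  Subquantale.coe_top_of_mem _ (show (⊤ : Q) * ⊤ ≤ ⊤ from le_top)

theorem coe_top_twoSidedPart : (⊤ : twoSidedPart Q).1 = ⊤ :=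
  Subquantale.coe_top_of_mem _
    (show (⊤ : Q) * ⊤ ≤ ⊤ ∧ (⊤ : Q) * ⊤ ≤ ⊤ from ⟨le_top, le_top⟩)

variable {Q}

theorem isBalanced_subquantale {S : Subquantale Q} (hS : (⊤ : S).1 = ⊤) (hb : IsBalanced Q) :
    IsBalanced S :=
  Subquantale.Elem.ext (by rw [Subquantale.coe_mul, hS]; exact hb)

theorem isBisymmetric_subquantale (S : Subquantale Q) (hb : IsBisymmetric Q) :
    IsBisymmetric S :=
  fun a b c d => Subquantale.Elem.ext (hb a.1 b.1 c.1 d.1)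

variable (Q)

/-- A balanced and bisymmetric quantale as an object of `BSQuant`. -/
def bsObj (hb : IsBalanced Q) (hs : IsBisymmetric Q) : BSQuant.{u} := ⟨Q, hb, hs⟩

/-- The left-sided elements of `Q`, as an object of `BSQuant`. -/
def bsLeft (hb : IsBalanced Q) (hs : IsBisymmetric Q) : BSQuant.{u} :=
  ⟨leftPart Q, isBalanced_subquantale (coe_top_leftPart Q) hb, isBisymmetric_subquantale _ hs⟩

/-- The right-sided elements of `Q`, as an object of `BSQuant`. -/
def bsRight (hb : IsBalanced Q) (hs : IsBisymmetric Q) : BSQuant.{u} :=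
  ⟨rightPart Q, isBalanced_subquantale (coe_top_rightPart Q) hb, isBisymmetric_subquantale _ hs⟩

/-- The two-sided elements of `Q`, as an object of `BSQuant`. -/
def bsTwoSided (hb : IsBalanced Q) (hs : IsBisymmetric Q) : BSQuant.{u} :=
  ⟨twoSidedPart Q, isBalanced_subquantale (coe_top_twoSidedPart Q) hb,
    isBisymmetric_subquantale _ hs⟩

variable {Q} in
/-- The four inclusions, as morphisms of `BSQuant`. -/
def inclTwoSidedLeft (hb : IsBalanced Q) (hs : IsBisymmetric Q) :
    bsTwoSided Q hb hs ⟶ bsLeft Q hb hs :=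
  { Subquantale.inclusion (S := twoSidedPart Q) (T := leftPart Q) (fun _ h => h.1) with
    map_top' := Subquantale.Elem.ext ((coe_top_twoSidedPart Q).trans (coe_top_leftPart Q).symm) }

variable {Q} in
def inclTwoSidedRight (hb : IsBalanced Q) (hs : IsBisymmetric Q) :
    bsTwoSided Q hb hs ⟶ bsRight Q hb hs :=
  { Subquantale.inclusion (S := twoSidedPart Q) (T := rightPart Q) (fun _ h => h.2) with
    map_top' := Subquantale.Elem.ext ((coe_top_twoSidedPart Q).trans (coe_top_rightPart Q).symm) }

variable {Q} in
def inclLeft (hb : IsBalanced Q) (hs : IsBisymmetric Q) : bsLeft Q hb hs ⟶ bsObj Q hb hs :=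
  { (leftPart Q).incl with map_top' := coe_top_leftPart Q }

variable {Q} in
def inclRight (hb : IsBalanced Q) (hs : IsBisymmetric Q) : bsRight Q hb hs ⟶ bsObj Q hb hs :=
  { (rightPart Q).incl with map_top' := coe_top_rightPart Q }

variable {Q} in
/-- A quantic frame is a bisymmetric and semi-unital quantale with an involution such that left-
and right-sided elements are idempotent, two-sided elements are hermitian, and the square of
inclusions of the two-sided, left-sided and right-sided elements is a pushout in `BSQuant`. -/
structure IsQuanticFrame (ℓ : Involution Q) : Prop where
  bisymmetric : IsBisymmetric Q
  semiUnital : IsSemiUnital Q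
  idempotent_of_leftSided : ∀ a : Q, IsLeftSided a → a * a = a
  idempotent_of_rightSided : ∀ a : Q, IsRightSided a → a * a = a
  hermitian_of_twoSided : ∀ a : Q, IsLeftSided a → IsRightSided a → ℓ a = a
  isPushout : IsPushout
    (inclTwoSidedLeft semiUnital.isBalanced bisymmetric)
    (inclTwoSidedRight semiUnital.isBalanced bisymmetric)
    (inclLeft semiUnital.isBalanced bisymmetric)
    (inclRight semiUnital.isBalanced bisymmetric)

end QuanticFrame

/-! ## Tensor products -/

/-- The tensor product of complete lattices, as the complete lattice of those lower sets of
`X × Y` that are closed under arbitrary (also empty) joins in each variable separately. -/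
@[ext]
structure Tensor (X Y : Type u) [CompleteLattice X] [CompleteLattice Y] where
  carrier : Set (X × Y)
  lower' : ∀ p q : X × Y, p ≤ q → q ∈ carrier → p ∈ carrier
  sSup_left' : ∀ (s : Set X) (y : Y), (∀ x ∈ s, (x, y) ∈ carrier) → (sSup s, y) ∈ carrier
  sSup_right' : ∀ (x : X) (t : Set Y), (∀ y ∈ t, (x, y) ∈ carrier) → (x, sSup t) ∈ carrier

namespace Tensor

section Lattice

variable {X Y : Type u} [CompleteLattice X] [CompleteLattice Y]

instance : PartialOrder (Tensor X Y) where
  le U V := U.carrier ⊆ V.carrier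
  le_refl _ := subset_rfl
  le_trans _ _ _ h k := Set.Subset.trans h k
  le_antisymm _ _ h k := Tensor.ext (Set.Subset.antisymm h k)

instance : InfSet (Tensor X Y) where
  sInf s :=
    { carrier := {p | ∀ U ∈ s, p ∈ U.carrier}
      lower' := fun p q h hq U hU => U.lower' p q h (hq U hU)
      sSup_left' := fun t y h U hU => U.sSup_left' t y fun x hx => h x hx U hU
      sSup_right' := fun x t h U hU => U.sSup_right' x t fun y hy => h y hy U hU }

instance : CompleteLattice (Tensor X Y) :=
  completeLatticeOfInf (Tensor X Y) fun _ =>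
    ⟨fun U hU _ hp => hp U hU, fun _ hV _ hp U hU => hV hU hp⟩

/-- The smallest tensor that contains a given set of pairs. -/
def gen (P : Set (X × Y)) : Tensor X Y := sInf {U | P ⊆ U.carrier}

theorem gen_le {P : Set (X × Y)} {U : Tensor X Y} : gen P ≤ U ↔ P ⊆ U.carrier :=
  ⟨fun h p hp => h fun _ hV => hV hp, fun h => sInf_le h⟩

/-- Elementary tensors. -/
def tmul (x : X) (y : Y) : Tensor X Y := gen {(x, y)}

theorem tmul_le {x : X} {y : Y} {U : Tensor X Y} : tmul x y ≤ U ↔ (x, y) ∈ U.carrier := by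
  rw [tmul, gen_le, Set.singleton_subset_iff]

theorem tmul_sSup_left (s : Set X) (y : Y) :
    tmul (sSup s) y = sSup ((fun x => tmul x y) '' s) := eq_of_forall_ge_iff fun Z => by
  simp only [tmul_le, sSup_le_iff, Set.forall_mem_image]
  exact ⟨fun h x hx => Z.lower' _ (sSup s, y) ⟨le_sSup hx, le_rfl⟩ h, Z.sSup_left' s y⟩

theorem tmul_sSup_right (x : X) (t : Set Y) :
    tmul x (sSup t) = sSup ((fun y => tmul x y) '' t) := eq_of_forall_ge_iff fun Z => by
  simp only [tmul_le, sSup_le_iff, Set.forall_mem_image]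
  exact ⟨fun h y hy => Z.lower' _ (x, sSup t) ⟨le_rfl, le_sSup hy⟩ h, Z.sSup_right' x t⟩

end Lattice

section Quantale

variable {X Y : Type u} [CompleteLattice X] [Semigroup X] [IsQuantale X]
  [CompleteLattice Y] [Semigroup Y] [IsQuantale Y]

/-- The multiplication, determined by `(a ⊗ b) * (c ⊗ d) = (a * c) ⊗ (b * d)`. -/
instance : Mul (Tensor X Y) := ⟨fun U V => gen (Set.image2 (fun p q => p * q) U.carrier V.carrier)⟩

theorem mul_le {U V W : Tensor X Y} :
    U * V ≤ W ↔ ∀ p ∈ U.carrier, ∀ q ∈ V.carrier, p * q ∈ W.carrier := by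
  change gen _ ≤ W ↔ _
  rw [gen_le, Set.image2_subset_iff]

/-- The tensor of all `p` with `p * q ∈ W`. -/
def resLeft (W : Tensor X Y) (q : X × Y) : Tensor X Y where
  carrier := {p | p * q ∈ W.carrier}
  lower' p p' h hp := W.lower' _ _ (⟨mul_le_mul_left h.1 q.1, mul_le_mul_left h.2 q.2⟩) hp
  sSup_left' s y h := by
    change (sSup s * q.1, y * q.2) ∈ W.carrier
    rw [sSup_mul_distrib, ← sSup_image]
    exact W.sSup_left' _ _ (by rintro _ ⟨x, hx, rfl⟩; exact h x hx)
  sSup_right' x t h := by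
    change (x * q.1, sSup t * q.2) ∈ W.carrier
    rw [sSup_mul_distrib, ← sSup_image]
    exact W.sSup_right' _ _ (by rintro _ ⟨y, hy, rfl⟩; exact h y hy)

/-- The tensor of all `q` with `p * q ∈ W`. -/
def resRight (W : Tensor X Y) (p : X × Y) : Tensor X Y where
  carrier := {q | p * q ∈ W.carrier}
  lower' q q' h hq := W.lower' _ _ (⟨mul_le_mul_right h.1 p.1, mul_le_mul_right h.2 p.2⟩) hq
  sSup_left' s y h := by
    change (p.1 * sSup s, p.2 * y) ∈ W.carrier
    rw [mul_sSup_distrib, ← sSup_image]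
    exact W.sSup_left' _ _ (by rintro _ ⟨x, hx, rfl⟩; exact h x hx)
  sSup_right' x t h := by
    change (p.1 * x, p.2 * sSup t) ∈ W.carrier
    rw [mul_sSup_distrib, ← sSup_image]
    exact W.sSup_right' _ _ (by rintro _ ⟨y, hy, rfl⟩; exact h y hy)

theorem mul_le_iff_left {U V W : Tensor X Y} :
    U * V ≤ W ↔ ∀ q ∈ V.carrier, U ≤ W.resLeft q :=
  mul_le.trans ⟨fun h q hq p hp => h p hp q hq, fun h _ hp q hq => h q hq hp⟩

theorem mul_le_iff_right {U V W : Tensor X Y} :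
    U * V ≤ W ↔ ∀ p ∈ U.carrier, V ≤ W.resRight p :=
  mul_le.trans ⟨fun h p hp q hq => h p hp q hq, fun h p hp _ hq => h p hp hq⟩

instance : Semigroup (Tensor X Y) where
  mul_assoc U V W := eq_of_forall_ge_iff fun Z => by
    rw [mul_le_iff_left, mul_le_iff_right]
    simp only [mul_le]
    constructor
    · intro h p hp q hq r hr
      change p * (q * r) ∈ Z.carrier
      rw [← mul_assoc]
      exact h r hr p hp q hq
    · intro h r hr p hp q hq
      change p * q * r ∈ Z.carrier
      rw [mul_assoc]
      exact h p hp q hq r hr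

instance : IsQuantale (Tensor X Y) where
  mul_sSup_distrib U s := eq_of_forall_ge_iff fun Z => by
    simp only [iSup_le_iff, mul_le_iff_right, sSup_le_iff]
    exact ⟨fun h V hV p hp => h p hp V hV, fun h p hp V hV => h V hV p hp⟩
  sSup_mul_distrib s U := eq_of_forall_ge_iff fun Z => by
    simp only [iSup_le_iff, mul_le_iff_left, sSup_le_iff]
    exact ⟨fun h V hV p hp => h p hp V hV, fun h p hp V hV => h V hV p hp⟩

theorem tmul_mul_tmul (a c : X) (b d : Y) :
    tmul a b * tmul c d = tmul (a * c) (b * d) := eq_of_forall_ge_iff fun Z => by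
  rw [mul_le_iff_left, tmul_le]
  constructor
  · intro h
    have h' : (a, b) ∈ (Z.resLeft (c, d)).carrier := tmul_le.mp (h (c, d) (tmul_le.mp le_rfl))
    exact h'
  · intro h q hq
    have h' : tmul c d ≤ Z.resRight (a, b) := tmul_le.mpr h
    exact tmul_le.mpr (h' hq)

/-- The canonical embedding `a ↦ a ⊗ ⊤`. -/
def inl (hY : IsBalanced Y) : QuantaleHom X (Tensor X Y) where
  toFun a := tmul a ⊤
  map_sSup' s := tmul_sSup_left s ⊤
  map_mul' a b := by rw [tmul_mul_tmul, hY]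

/-- The canonical embedding `b ↦ ⊤ ⊗ b`. -/
def inr (hX : IsBalanced X) : QuantaleHom Y (Tensor X Y) where
  toFun b := tmul ⊤ b
  map_sSup' s := tmul_sSup_right ⊤ s
  map_mul' a b := by rw [tmul_mul_tmul, hX]

end Quantale

end Tensor

/-! ## Nuclei, their quotients, and coequalizers -/

/-- A (quantic) nucleus: a closure operator `c` with `c a * c b ≤ c (a * b)`. -/
structure QuanticNucleus (Q : Type u) [CompleteLattice Q] [Semigroup Q] extends
    ClosureOperator Q where
  mul_le' : ∀ a b, toFun a * toFun b ≤ toFun (a * b)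

namespace QuanticNucleus

variable {Q : Type u} [CompleteLattice Q] [Semigroup Q]

/-- The pointwise meet of a set of nuclei. -/
def inf [IsQuantale Q] (N : Set (QuanticNucleus Q)) : QuanticNucleus Q where
  toClosureOperator := ClosureOperator.mk' (fun a => ⨅ c ∈ N, c.toClosureOperator a)
    (fun _ _ h => iInf₂_mono fun c _ => c.monotone h)
    (fun a => le_iInf₂ fun c _ => c.le_closure a)
    (fun a => le_iInf₂ fun c hc => (iInf₂_le c hc).trans
      (by
        rw [← c.idempotent a]
        exact c.monotone (iInf₂_le c hc)))
  mul_le' a b := le_iInf₂ fun c hc =>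
    (mul_le_mul' (iInf₂_le c hc) (iInf₂_le c hc)).trans (c.mul_le' a b)

variable (c : QuanticNucleus Q)

/-- The quotient of a quantale by a nucleus: the fixed points of the nucleus. -/
@[ext]
structure Quotient (c : QuanticNucleus Q) : Type u where
  val : Q
  fixed : c.toClosureOperator val = val

instance : PartialOrder c.Quotient := PartialOrder.lift Quotient.val fun _ _ => Quotient.ext

/-- The quotient map. -/
def proj (a : Q) : c.Quotient := ⟨c.toClosureOperator a, c.idempotent a⟩

theorem proj_le {a : Q} {x : c.Quotient} : c.proj a ≤ x ↔ a ≤ x.1 :=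
  ⟨fun h => (c.le_closure a).trans h, fun h => (c.monotone h).trans x.fixed.le⟩

theorem proj_val (x : c.Quotient) : c.proj x.1 = x := Quotient.ext x.fixed

/-- The fixed points carry the induced order, and joins are closures of joins. -/
instance : SupSet c.Quotient := ⟨fun s => c.proj (sSup (Quotient.val '' s))⟩

instance : CompleteLattice c.Quotient :=
  completeLatticeOfSup c.Quotient fun s => by
    refine ⟨fun x hx => ?_, fun y hy => ?_⟩
    · exact (le_sSup (Set.mem_image_of_mem Quotient.val hx)).trans (c.le_closure _)
    · refine c.proj_le.mpr (sSup_le ?_)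
      rintro _ ⟨x, hx, rfl⟩
      exact hy hx

theorem proj_sSup (s : Set Q) : c.proj (sSup s) = sSup (c.proj '' s) :=
  eq_of_forall_ge_iff fun x => by
    simp only [proj_le, sSup_le_iff, Set.forall_mem_image]

/-- The multiplication of the quotient is `x * y = c (x * y)`. -/
instance : Mul c.Quotient := ⟨fun x y => c.proj (x.1 * y.1)⟩

theorem proj_mul [IsQuantale Q] (a b : Q) : c.proj (a * b) = c.proj a * c.proj b := by
  apply le_antisymm
  · rw [proj_le]
    exact (mul_le_mul' (c.le_closure a) (c.le_closure b)).trans (c.le_closure _)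
  · change c.proj (c.toClosureOperator a * c.toClosureOperator b) ≤ _
    rw [proj_le]
    exact c.mul_le' a b

instance [IsQuantale Q] : Semigroup c.Quotient where
  mul_assoc x y z := by
    rw [← c.proj_val x, ← c.proj_val y, ← c.proj_val z]
    simp only [← proj_mul, mul_assoc]

theorem proj_iSup₂ (s : Set Q) (f : Q → Q) :
    c.proj (⨆ y ∈ s, f y) = ⨆ y ∈ s, c.proj (f y) := by
  rw [← sSup_image, proj_sSup, Set.image_image, sSup_image]

theorem sSup_eq (s : Set c.Quotient) : sSup s = c.proj (sSup (Quotient.val '' s)) := rfl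

instance [IsQuantale Q] : IsQuantale c.Quotient where
  mul_sSup_distrib x s := by
    rw [sSup_eq]
    nth_rewrite 1 [← c.proj_val x]
    rw [← proj_mul, mul_sSup_distrib, proj_iSup₂, iSup_image]
    rfl
  sSup_mul_distrib s x := by
    rw [sSup_eq]
    nth_rewrite 1 [← c.proj_val x]
    rw [← proj_mul, sSup_mul_distrib, proj_iSup₂, iSup_image]
    rfl

/-- The quotient map as a quantale homomorphism. -/
def projHom [IsQuantale Q] : QuantaleHom Q c.Quotient where
  toFun := c.proj
  map_sSup' := c.proj_sSup
  map_mul' := c.proj_mul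

end QuanticNucleus

section Coequalizer

variable {S Q : Type u} [CompleteLattice S] [Semigroup S] [CompleteLattice Q] [Semigroup Q]
  [IsQuantale Q]

/-- The nucleus of the coequalizer of `f` and `g`: the pointwise meet of all nuclei `c` with
`c ∘ f = c ∘ g`. -/
def coeqNucleus (f g : QuantaleHom S Q) : QuanticNucleus Q :=
  QuanticNucleus.inf {c | ∀ s, c.toClosureOperator (f s) = c.toClosureOperator (g s)}

/-- The coequalizer of two quantale homomorphisms. -/
abbrev Coeq (f g : QuantaleHom S Q) : Type u := (coeqNucleus f g).Quotient

/-- The projection onto the coequalizer. -/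
def coeqProj (f g : QuantaleHom S Q) : QuantaleHom Q (Coeq f g) := (coeqNucleus f g).projHom

theorem coeqProj_condition (f g : QuantaleHom S Q) (s : S) :
    coeqProj f g (f s) = coeqProj f g (g s) :=
  QuanticNucleus.Quotient.ext (iInf_congr fun _ => iInf_congr fun hc => hc s)

end Coequalizer

/-! ## The quantales of closed subspaces and closed ideals of a C*-algebra -/

section CStar

variable (A : Type u) [CStarAlgebra A]

/-- The complete lattice of all closed linear subspaces of `A`. -/
abbrev MaxA : Type u := ClosedSubmodule ℂ A

variable {A}

/-- The product of two closed subspaces is the closure of the linear span of all products. -/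
instance : Mul (MaxA A) :=
  ⟨fun M N => (ClosedSubmodule.toSubmodule M * ClosedSubmodule.toSubmodule N).closure⟩

namespace MaxA

theorem mul_le {M N P : MaxA A} : M * N ≤ P ↔ ∀ a ∈ M, ∀ b ∈ N, a * b ∈ P :=
  (Submodule.closure_le (t := P)).trans Submodule.mul_le

/-- The closed subspace of all `a` with `a * b ∈ P`. -/
def resLeft (P : MaxA A) (b : A) : MaxA A :=
  ClosedSubmodule.comap ((ContinuousLinearMap.mul ℂ A).flip b) P

/-- The closed subspace of all `b` with `a * b ∈ P`. -/
def resRight (P : MaxA A) (a : A) : MaxA A :=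
  ClosedSubmodule.comap (ContinuousLinearMap.mul ℂ A a) P

theorem mul_le_iff_left {M N P : MaxA A} : M * N ≤ P ↔ ∀ b ∈ N, M ≤ P.resLeft b :=
  mul_le.trans ⟨fun h b hb a ha => h a ha b hb, fun h _ ha b hb => h b hb ha⟩

theorem mul_le_iff_right {M N P : MaxA A} : M * N ≤ P ↔ ∀ a ∈ M, N ≤ P.resRight a :=
  mul_le.trans ⟨fun h a ha b hb => h a ha b hb, fun h a ha _ hb => h a ha hb⟩

instance : Semigroup (MaxA A) where
  mul_assoc M N P := eq_of_forall_ge_iff fun Z => by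
    rw [mul_le_iff_left, mul_le_iff_right]
    simp only [mul_le]
    constructor
    · intro h a ha b hb c hc
      change a * (b * c) ∈ Z
      rw [← mul_assoc]
      exact h c hc a ha b hb
    · intro h c hc a ha b hb
      change a * b * c ∈ Z
      rw [mul_assoc]
      exact h a ha b hb c hc

instance : IsQuantale (MaxA A) where
  mul_sSup_distrib M s := eq_of_forall_ge_iff fun Z => by
    simp only [iSup_le_iff, mul_le_iff_right, sSup_le_iff]
    exact ⟨fun h V hV p hp => h p hp V hV, fun h p hp V hV => h V hV p hp⟩
  sSup_mul_distrib s M := eq_of_forall_ge_iff fun Z => by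
    simp only [iSup_le_iff, mul_le_iff_left, sSup_le_iff]
    exact ⟨fun h V hV p hp => h p hp V hV, fun h p hp V hV => h V hV p hp⟩

/-- The adjoint `{a* | a ∈ M}` of a closed subspace. -/
def adj (M : MaxA A) : MaxA A where
  carrier := {a | star a ∈ M}
  add_mem' ha hb := by
    change star (_ + _) ∈ M
    rw [star_add]
    exact (ClosedSubmodule.toSubmodule M).add_mem ha hb
  zero_mem' := by
    change star 0 ∈ M
    rw [star_zero]
    exact (ClosedSubmodule.toSubmodule M).zero_mem
  smul_mem' z a ha := by
    change star (z • a) ∈ M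
    rw [star_smul]
    exact (ClosedSubmodule.toSubmodule M).smul_mem _ ha
  isClosed' := (ClosedSubmodule.isClosed M).preimage continuous_star

theorem mem_adj {M : MaxA A} {a : A} : a ∈ M.adj ↔ star a ∈ M := Iff.rfl

theorem adj_adj (M : MaxA A) : M.adj.adj = M :=
  SetLike.ext fun a => by rw [mem_adj, mem_adj, star_star]

theorem adj_le_iff {M N : MaxA A} : M.adj ≤ N ↔ M ≤ N.adj :=
  ⟨fun h a ha => h (by rw [mem_adj, star_star]; exact ha),
   fun h a ha => by have := h ha; rwa [mem_adj, star_star] at this⟩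

theorem adj_mul (M N : MaxA A) : (M * N).adj = N.adj * M.adj :=
  eq_of_forall_ge_iff fun P => by
    rw [adj_le_iff, mul_le, mul_le]
    constructor
    · intro h b hb a ha
      have := h _ ha _ hb
      rwa [mem_adj, star_mul, star_star, star_star] at this
    · intro h a ha b hb
      rw [mem_adj, star_mul]
      exact h _ (by rwa [mem_adj, star_star]) _ (by rwa [mem_adj, star_star])

end MaxA

variable (A)

/-- The quantale of all closed left ideals. -/
def closedLeftIdeals : Subquantale (MaxA A) where
  carrier := {M | ∀ a : A, ∀ x ∈ M, a * x ∈ M}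
  sSup_mem' s hs a := by
    change sSup s ≤ (sSup s).resRight a
    exact sSup_le fun M hM x hx => le_sSup hM (hs hM a x hx)
  mul_mem' M hM N _ a := by
    change M * N ≤ (M * N).resRight a
    refine MaxA.mul_le.mpr fun x hx y hy => ?_
    change a * (x * y) ∈ M * N
    rw [← mul_assoc]
    exact MaxA.mul_le.mp le_rfl _ (hM a x hx) y hy

/-- The quantale of all closed right ideals. -/
def closedRightIdeals : Subquantale (MaxA A) where
  carrier := {M | ∀ a : A, ∀ x ∈ M, x * a ∈ M}
  sSup_mem' s hs a := by
    change sSup s ≤ (sSup s).resLeft a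
    exact sSup_le fun M hM x hx => le_sSup hM (hs hM a x hx)
  mul_mem' M _ N hN a := by
    change M * N ≤ (M * N).resLeft a
    refine MaxA.mul_le.mpr fun x hx y hy => ?_
    change x * y * a ∈ M * N
    rw [mul_assoc]
    exact MaxA.mul_le.mp le_rfl x hx _ (hN a y hy)

/-- The quantale of all closed two-sided ideals. -/
def closedIdeals : Subquantale (MaxA A) where
  carrier := (closedLeftIdeals A).carrier ∩ (closedRightIdeals A).carrier
  sSup_mem' s hs := ⟨(closedLeftIdeals A).sSup_mem' s fun _ h => (hs h).1,
    (closedRightIdeals A).sSup_mem' s fun _ h => (hs h).2⟩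
  mul_mem' M hM N hN := ⟨(closedLeftIdeals A).mul_mem' M hM.1 N hN.1,
    (closedRightIdeals A).mul_mem' M hM.2 N hN.2⟩

theorem isBalanced_maxA : IsBalanced (MaxA A) :=
  top_le_iff.mp fun a _ => by
    rw [← one_mul a]
    exact MaxA.mul_le.mp le_rfl 1 ClosedSubmodule.mem_top a ClosedSubmodule.mem_top

theorem isBalanced_closedLeftIdeals : IsBalanced (closedLeftIdeals A) :=
  isBalanced_subquantale (Subquantale.coe_top_of_mem _ fun _ _ _ => ClosedSubmodule.mem_top) (isBalanced_maxA A)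

theorem isBalanced_closedRightIdeals : IsBalanced (closedRightIdeals A) :=
  isBalanced_subquantale (Subquantale.coe_top_of_mem _ fun _ _ _ => ClosedSubmodule.mem_top) (isBalanced_maxA A)

/-- The inclusion of closed two-sided ideals into closed left ideals. -/
def toLeftIdeals : QuantaleHom (closedIdeals A) (closedLeftIdeals A) :=
  Subquantale.inclusion fun _ h => h.1

/-- The inclusion of closed two-sided ideals into closed right ideals. -/
def toRightIdeals : QuantaleHom (closedIdeals A) (closedRightIdeals A) :=
  Subquantale.inclusion fun _ h => h.2

/-- The tensor product of the quantales of closed left and of closed right ideals. -/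
abbrev IdealTensor : Type u := Tensor (closedLeftIdeals A) (closedRightIdeals A)

/-- The homomorphism `I ↦ I ⊗ ⊤` from closed two-sided ideals. -/
def idealInl : QuantaleHom (closedIdeals A) (IdealTensor A) where
  toFun I := Tensor.inl (isBalanced_closedRightIdeals A) (toLeftIdeals A I)
  map_sSup' s := by
    rw [(toLeftIdeals A).map_sSup', (Tensor.inl _).map_sSup', Set.image_image]
  map_mul' I J := by rw [(toLeftIdeals A).map_mul', (Tensor.inl _).map_mul']

/-- The homomorphism `I ↦ ⊤ ⊗ I` from closed two-sided ideals. -/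
def idealInr : QuantaleHom (closedIdeals A) (IdealTensor A) where
  toFun I := Tensor.inr (isBalanced_closedLeftIdeals A) (toRightIdeals A I)
  map_sSup' s := by
    rw [(toRightIdeals A).map_sSup', (Tensor.inr _).map_sSup', Set.image_image]
  map_mul' I J := by rw [(toRightIdeals A).map_mul', (Tensor.inr _).map_mul']

/-- The spectrum of `A`: the coequalizer of `I ↦ I ⊗ ⊤` and `I ↦ ⊤ ⊗ I`. -/
abbrev Spec : Type u := Coeq (idealInl A) (idealInr A)

/-- The projection from the tensor product onto the spectrum. -/
def specProj : QuantaleHom (IdealTensor A) (Spec A) := coeqProj (idealInl A) (idealInr A)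

/-- The two parallel maps and the projection, as morphisms of `Quant`. -/
def quantIdealInl : Quant.of (closedIdeals A) ⟶ Quant.of (IdealTensor A) := idealInl A

def quantIdealInr : Quant.of (closedIdeals A) ⟶ Quant.of (IdealTensor A) := idealInr A

def quantSpecProj : Quant.of (IdealTensor A) ⟶ Quant.of (Spec A) := specProj A

theorem quantSpecProj_condition :
    quantIdealInl A ≫ quantSpecProj A = quantIdealInr A ≫ quantSpecProj A :=
  QuantaleHom.ext (funext fun I => coeqProj_condition (idealInl A) (idealInr A) I)

variable {A}

/-- The adjoint of a closed left ideal, a closed right ideal. -/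
def leftAdj (M : closedLeftIdeals A) : closedRightIdeals A :=
  ⟨M.1.adj, fun a x hx => by
    rw [MaxA.mem_adj, star_mul]
    exact M.2 _ _ hx⟩

/-- The adjoint of a closed right ideal, a closed left ideal. -/
def rightAdj (N : closedRightIdeals A) : closedLeftIdeals A :=
  ⟨N.1.adj, fun a x hx => by
    rw [MaxA.mem_adj, star_mul]
    exact N.2 _ _ hx⟩

theorem rightAdj_leftAdj (M : closedLeftIdeals A) : rightAdj (leftAdj M) = M :=
  Subquantale.Elem.ext M.1.adj_adj

theorem leftAdj_rightAdj (N : closedRightIdeals A) : leftAdj (rightAdj N) = N :=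
  Subquantale.Elem.ext N.1.adj_adj

theorem leftAdj_mul (M N : closedLeftIdeals A) : leftAdj (M * N) = leftAdj N * leftAdj M :=
  Subquantale.Elem.ext (MaxA.adj_mul M.1 N.1)

theorem rightAdj_mul (M N : closedRightIdeals A) :
    rightAdj (M * N) = rightAdj N * rightAdj M :=
  Subquantale.Elem.ext (MaxA.adj_mul M.1 N.1)

/-- Taking adjoints is an order isomorphism between closed left and closed right ideals. -/
def adjIso : closedLeftIdeals A ≃o closedRightIdeals A where
  toFun := leftAdj
  invFun := rightAdj
  left_inv := rightAdj_leftAdj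
  right_inv := leftAdj_rightAdj
  map_rel_iff' {M N} := MaxA.adj_le_iff.trans (by
    change M.1 ≤ N.1.adj.adj ↔ M.1 ≤ N.1
    rw [MaxA.adj_adj])

theorem leftAdj_sSup (s : Set (closedLeftIdeals A)) : leftAdj (sSup s) = sSup (leftAdj '' s) := by
  rw [sSup_image]
  exact adjIso.map_sSup s

theorem rightAdj_sSup (s : Set (closedRightIdeals A)) :
    rightAdj (sSup s) = sSup (rightAdj '' s) := by
  rw [sSup_image]
  exact adjIso.symm.map_sSup s

/-- The image of a tensor under `(M, N) ↦ (N*, M*)`. -/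
def tensorAdj (U : IdealTensor A) : IdealTensor A where
  carrier := {p | (rightAdj p.2, leftAdj p.1) ∈ U.carrier}
  lower' p q h hq := U.lower' _ (rightAdj q.2, leftAdj q.1)
    ⟨adjIso.symm.monotone h.2, adjIso.monotone h.1⟩ hq
  sSup_left' s y h := by
    change (rightAdj y, leftAdj (sSup s)) ∈ U.carrier
    rw [leftAdj_sSup]
    exact U.sSup_right' _ _ (by rintro _ ⟨x, hx, rfl⟩; exact h x hx)
  sSup_right' x t h := by
    change (rightAdj (sSup t), leftAdj x) ∈ U.carrier
    rw [rightAdj_sSup]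
    exact U.sSup_left' _ _ (by rintro _ ⟨y, hy, rfl⟩; exact h y hy)

theorem tensorAdj_tensorAdj (U : IdealTensor A) : tensorAdj (tensorAdj U) = U :=
  Tensor.ext (Set.ext fun p => by
    change (rightAdj (leftAdj p.1), leftAdj (rightAdj p.2)) ∈ U.carrier ↔ _
    rw [rightAdj_leftAdj, leftAdj_rightAdj])

theorem tensorAdj_le_iff {U V : IdealTensor A} : tensorAdj U ≤ V ↔ U ≤ tensorAdj V := by
  have key : ∀ {U V : IdealTensor A}, U ≤ V → tensorAdj U ≤ tensorAdj V := fun h _ hp => h hp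
  exact ⟨fun h => tensorAdj_tensorAdj U ▸ key h, fun h => tensorAdj_tensorAdj V ▸ key h⟩

theorem tensorAdj_tmul (M : closedLeftIdeals A) (N : closedRightIdeals A) :
    tensorAdj (Tensor.tmul M N) = Tensor.tmul (rightAdj N) (leftAdj M) :=
  eq_of_forall_ge_iff fun U => by
    rw [tensorAdj_le_iff, Tensor.tmul_le, Tensor.tmul_le]
    rfl

theorem mem_tensorAdj {U : IdealTensor A} {M : closedLeftIdeals A} {N : closedRightIdeals A} :
    (M, N) ∈ (tensorAdj U).carrier ↔ (rightAdj N, leftAdj M) ∈ U.carrier := Iff.rfl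

theorem tensorAdj_mul_le {U V W : IdealTensor A} (h : U * V ≤ tensorAdj W) :
    tensorAdj V * tensorAdj U ≤ W := by
  refine Tensor.mul_le.mpr ?_
  rintro ⟨M, N⟩ hp ⟨M', N'⟩ hq
  rw [mem_tensorAdj] at hp hq
  have := Tensor.mul_le.mp h _ hq _ hp
  rw [Prod.mk_mul_mk, mem_tensorAdj, leftAdj_mul, rightAdj_mul] at this
  simpa only [leftAdj_rightAdj, rightAdj_leftAdj, Prod.mk_mul_mk] using this

theorem tensorAdj_mul (U V : IdealTensor A) :
    tensorAdj (U * V) = tensorAdj V * tensorAdj U := by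
  apply le_antisymm
  · rw [tensorAdj_le_iff]
    have h : tensorAdj V * tensorAdj U ≤ tensorAdj (tensorAdj (tensorAdj V * tensorAdj U)) :=
      (tensorAdj_tensorAdj _).ge
    have := tensorAdj_mul_le h
    rwa [tensorAdj_tensorAdj, tensorAdj_tensorAdj] at this
  · exact tensorAdj_mul_le (tensorAdj_tensorAdj _).ge

/-- The involution of the tensor product, determined by `(M ⊗ N)' = N* ⊗ M*`. -/
def tensorInvolution : Involution (IdealTensor A) where
  toFun := tensorAdj
  map_sSup' s := eq_of_forall_ge_iff fun V => by
    simp only [tensorAdj_le_iff, sSup_le_iff, Set.forall_mem_image]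
  map_mul' := tensorAdj_mul
  involutive' := tensorAdj_tensorAdj

end CStar

end QuanticSpectrum

end

open QuanticSpectrum

/-!
The spectrum is a quotient of the tensor product of the closed left and the closed right ideals,
and almost everything about it can be computed on elementary tensors `π (M ⊗ N)`. Analysis enters
in one place only: by `exists_norm_sub_mul_star_mul_self_le`, every `x` is a limit of elements
`x * (b * (star x * x))`. Hence a closed left ideal is idempotent, a closed two-sided ideal is
self-adjoint, and two closed two-sided ideals commute. Since a left ideal absorbs `⊤` on its left
and a right ideal absorbs `⊤` on its right, commuting two-sided ideals make the quantales of left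
and of right ideals bisymmetric (`MaxA.mul_top_mul_comm`), and so is the spectrum.

The coequalizer property is formal: the kernel of a homomorphism that identifies `I ⊗ ⊤` with
`⊤ ⊗ I` is a nucleus that identifies them as well (`coeqDesc`). The involution descends to the
quotient because conjugation by it permutes the nuclei with this property
(`coeqNucleus_tensorAdj`).

The key computation is `top_mul_spec`. For a two-sided ideal `J`,
`M ⊗ J = (⊤ ⊗ J) * (M ⊗ ⊤)` is identified with `(J ⊗ ⊤) * (M ⊗ ⊤) = (J * M) ⊗ ⊤`, so left-sided
elements have the form `π (M ⊗ ⊤)`. The homomorphism `specRetract` recovers `M` from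
`π (M ⊗ ⊤)`, which gives the isomorphism of left ideals with left-sided elements; right-sided
elements are handled by the involution, and two-sided elements come from two-sided ideals.

For the pushout property, `M ⊗ N = (⊤ ⊗ N) * (M ⊗ ⊤)` leaves no choice for a homomorphism with
given values `g` on left-sided and `h` on right-sided elements: it sends `π (M ⊗ N)` to
`h (⊤ ⊗ N) * g (M ⊗ ⊤)`, and bisymmetry of the target makes this multiplicative (`specDesc`). If
`A` is commutative, every element is left-sided, all left ideals are two-sided, and `specRetract`
is the isomorphism onto the closed ideals, whose product is their intersection.
-/

noncomputable section

namespace QuanticSpectrum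

open CategoryTheory

/-! ### Homomorphisms, nuclei and coequalizers of quantales -/

section Quantales

variable {Q R : Type u} [CompleteLattice Q] [Semigroup Q] [CompleteLattice R] [Semigroup R]

theorem QuantaleHom.monotone (f : QuantaleHom Q R) : Monotone f :=
  OrderHomClass.mono f.tosSupHom

/-- The composite of two quantale homomorphisms. -/
def QuantaleHom.comp {T : Type u} [CompleteLattice T] [Semigroup T] (g : QuantaleHom R T)
    (f : QuantaleHom Q R) : QuantaleHom Q T where
  toFun a := g (f a)
  map_sSup' s := by rw [f.map_sSup', g.map_sSup', Set.image_image]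
  map_mul' a b := by rw [f.map_mul', g.map_mul']

/-- The set of all `b` with `h b ≤ h a` has a greatest element. -/
theorem QuantaleHom.map_sSup_le (h : QuantaleHom Q R) (a : Q) :
    h (sSup {b | h b ≤ h a}) ≤ h a := by
  rw [h.map_sSup', sSup_le_iff, Set.forall_mem_image]
  exact fun b hb => hb

theorem mul_biSup_distrib {ι : Type*} [IsQuantale Q] (a : Q) (s : Set ι) (f : ι → Q) :
    a * ⨆ i ∈ s, f i = ⨆ i ∈ s, a * f i := by
  rw [← sSup_image, mul_sSup_distrib, iSup_image]

theorem biSup_mul_distrib {ι : Type*} [IsQuantale Q] (a : Q) (s : Set ι) (f : ι → Q) :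
    (⨆ i ∈ s, f i) * a = ⨆ i ∈ s, f i * a := by
  rw [← sSup_image, sSup_mul_distrib, iSup_image]

/-- The nucleus induced by a quantale homomorphism `h`: it sends `a` to the largest `b` with
`h b ≤ h a`. -/
def kerNucleus [IsQuantale Q] [IsQuantale R] (h : QuantaleHom Q R) : QuanticNucleus Q where
  toClosureOperator := ClosureOperator.mk' (fun a => sSup {b | h b ≤ h a})
    (fun _ _ hab => sSup_le fun _ hb => le_sSup (le_trans hb (h.monotone hab)))
    (fun _ => le_sSup (le_refl (h _)))
    (fun a => sSup_le fun _ hb => le_sSup (le_trans hb (h.map_sSup_le a)))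
  mul_le' a b := le_sSup (by
    change h (_ * _) ≤ h (a * b)
    rw [h.map_mul', h.map_mul']
    exact mul_le_mul' (h.map_sSup_le a) (h.map_sSup_le b))

theorem kerNucleus_le_iff [IsQuantale Q] [IsQuantale R] (h : QuantaleHom Q R) {a b : Q} :
    b ≤ (kerNucleus h).toClosureOperator a ↔ h b ≤ h a :=
  ⟨fun hb => (h.monotone hb).trans (h.map_sSup_le a), fun hb => le_sSup hb⟩

theorem coeqNucleus_le {S : Type u} [CompleteLattice S] [Semigroup S] [IsQuantale Q]
    {f g : QuantaleHom S Q} {c : QuanticNucleus Q}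
    (hc : ∀ s, c.toClosureOperator (f s) = c.toClosureOperator (g s)) (a : Q) :
    (coeqNucleus f g).toClosureOperator a ≤ c.toClosureOperator a :=
  iInf₂_le (f := fun (c : QuanticNucleus Q) _ => c.toClosureOperator a) c hc

theorem coeqProj_val {S : Type u} [CompleteLattice S] [Semigroup S] [IsQuantale Q]
    {f g : QuantaleHom S Q} (x : Coeq f g) : coeqProj f g x.val = x :=
  (coeqNucleus f g).proj_val x

/-- A homomorphism that equalizes `f` and `g` does not see the nucleus of their coequalizer, which
lies below its kernel. -/
theorem map_coeqNucleus {S : Type u} [CompleteLattice S] [Semigroup S] [IsQuantale Q]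
    [IsQuantale R] {f g : QuantaleHom S Q} (h : QuantaleHom Q R) (hfg : ∀ s, h (f s) = h (g s))
    (a : Q) : h ((coeqNucleus f g).toClosureOperator a) = h a := by
  refine le_antisymm ?_ (h.monotone ((coeqNucleus f g).le_closure a))
  rw [← kerNucleus_le_iff]
  refine coeqNucleus_le (fun s => eq_of_forall_le_iff fun b => ?_) a
  rw [kerNucleus_le_iff, kerNucleus_le_iff, hfg]

/-- The homomorphism out of a coequalizer induced by a homomorphism that equalizes the two
given ones. -/
def coeqDesc {S : Type u} [CompleteLattice S] [Semigroup S] [IsQuantale Q]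
    [IsQuantale R] {f g : QuantaleHom S Q} (h : QuantaleHom Q R) (hfg : ∀ s, h (f s) = h (g s)) :
    QuantaleHom (Coeq f g) R where
  toFun x := h x.val
  map_sSup' s := by
    change h ((coeqNucleus f g).toClosureOperator _) = _
    rw [map_coeqNucleus h hfg, h.map_sSup', Set.image_image]
  map_mul' x y := by
    change h ((coeqNucleus f g).toClosureOperator _) = _
    rw [map_coeqNucleus h hfg, h.map_mul']

theorem coeqDesc_coeqProj {S : Type u} [CompleteLattice S] [Semigroup S] [IsQuantale Q]
    [IsQuantale R] {f g : QuantaleHom S Q} (h : QuantaleHom Q R) (hfg : ∀ s, h (f s) = h (g s))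
    (a : Q) : coeqDesc h hfg (coeqProj f g a) = h a :=
  map_coeqNucleus h hfg a

end Quantales

/-! ### The universal property of the tensor product -/

namespace Tensor

variable {X Y T : Type u} [CompleteLattice X] [CompleteLattice Y] [CompleteLattice T]

theorem eq_sSup_tmul (U : Tensor X Y) :
    U = sSup ((fun p : X × Y => tmul p.1 p.2) '' U.carrier) :=
  eq_of_forall_ge_iff fun Z => by
    simp only [sSup_le_iff, Set.forall_mem_image, tmul_le]
    rfl

theorem top_eq_tmul : (⊤ : Tensor X Y) = tmul ⊤ ⊤ :=
  (top_le_iff.mp fun p _ => (tmul ⊤ ⊤).lower' p (⊤, ⊤) le_top (tmul_le.mp le_rfl)).symm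

/-- The pairs that a map `φ` in two variables, join-preserving in each, sends below `z`. -/
def below (φ : X → Y → T) (hl : ∀ s y, φ (sSup s) y = sSup ((fun x => φ x y) '' s))
    (hr : ∀ x t, φ x (sSup t) = sSup (φ x '' t)) (z : T) : Tensor X Y where
  carrier := {p | φ p.1 p.2 ≤ z}
  lower' p q hpq hq := by
    have h1 : Monotone fun x => φ x p.2 :=
      OrderHomClass.mono (⟨_, fun s => hl s p.2⟩ : sSupHom X T)
    have h2 : Monotone (φ q.1) := OrderHomClass.mono (⟨_, hr q.1⟩ : sSupHom Y T)
    exact ((h1 hpq.1).trans (h2 hpq.2)).trans hq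
  sSup_left' s y h := by
    change φ (sSup s) y ≤ z
    rw [hl, sSup_le_iff, Set.forall_mem_image]
    exact h
  sSup_right' x t h := by
    change φ x (sSup t) ≤ z
    rw [hr, sSup_le_iff, Set.forall_mem_image]
    exact h

variable [Semigroup X] [IsQuantale X] [Semigroup Y] [IsQuantale Y] [Semigroup T] [IsQuantale T]

/-- The quantale homomorphism on a tensor product that is given on elementary tensors by a
multiplicative map which preserves joins in each variable. -/
def lift (φ : X → Y → T) (hl : ∀ s y, φ (sSup s) y = sSup ((fun x => φ x y) '' s))
    (hr : ∀ x t, φ x (sSup t) = sSup (φ x '' t))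
    (hm : ∀ a b c d, φ (a * c) (b * d) = φ a b * φ c d) : QuantaleHom (Tensor X Y) T :=
  have key : ∀ (U : Tensor X Y) (z : T),
      sSup ((fun p : X × Y => φ p.1 p.2) '' U.carrier) ≤ z ↔ U ≤ below φ hl hr z := fun U z => by
    rw [sSup_le_iff, Set.forall_mem_image]
    rfl
  { toFun := fun U => sSup ((fun p => φ p.1 p.2) '' U.carrier)
    map_sSup' := fun s => eq_of_forall_ge_iff fun z => by
      rw [key, sSup_le_iff, sSup_le_iff, Set.forall_mem_image]
      simp only [key]
    map_mul' := fun U V => eq_of_forall_ge_iff fun z => by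
      rw [key, mul_le, sSup_mul_distrib]
      simp only [mul_sSup_distrib, iSup_le_iff, Set.forall_mem_image, ← hm]
      rfl }

theorem lift_tmul (φ : X → Y → T) (hl : ∀ s y, φ (sSup s) y = sSup ((fun x => φ x y) '' s))
    (hr : ∀ x t, φ x (sSup t) = sSup (φ x '' t))
    (hm : ∀ a b c d, φ (a * c) (b * d) = φ a b * φ c d) (x : X) (y : Y) :
    lift φ hl hr hm (tmul x y) = φ x y :=
  eq_of_forall_ge_iff fun z => by
    have h : lift φ hl hr hm (tmul x y) ≤ z ↔ tmul x y ≤ below φ hl hr z := by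
      change sSup _ ≤ z ↔ _
      rw [sSup_le_iff, Set.forall_mem_image]
      rfl
    rw [h, tmul_le]
    rfl

end Tensor

/-! ### Closed ideals of a C*-algebra -/

section Ideals

variable {A : Type u} [CStarAlgebra A]

/-- Every `x` is a limit of elements `x * (b * (star x * x))`. The approximation takes
`b = (δ + star x * x)⁻¹` for `δ = ε ^ 2`. -/
theorem exists_norm_sub_mul_star_mul_self_le (x : A) {ε : ℝ} (hε : 0 < ε) :
    ∃ b : A, ‖x - x * (b * (star x * x))‖ ≤ ε := by
  have hsa : IsSelfAdjoint (star x * x) := IsSelfAdjoint.star_mul_self x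
  have hnn : ∀ t ∈ spectrum ℝ (star x * x), 0 ≤ t := spectrum_star_mul_self_nonneg
  have hδ : 0 < ε ^ 2 := by positivity
  have hne : ∀ t ∈ spectrum ℝ (star x * x), ε ^ 2 + t ≠ 0 := fun t ht => by
    have := hnn t ht
    positivity
  have hid : ContinuousOn (fun t : ℝ => t) (spectrum ℝ (star x * x)) := by fun_prop
  have hc : ContinuousOn (fun t : ℝ => (ε ^ 2 + t)⁻¹) (spectrum ℝ (star x * x)) :=
    ContinuousOn.inv₀ (by fun_prop) hne
  have hc' : ContinuousOn (fun t : ℝ => ε ^ 2 * (ε ^ 2 + t)⁻¹) (spectrum ℝ (star x * x)) :=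
    continuousOn_const.mul hc
  refine ⟨cfc (fun t : ℝ => (ε ^ 2 + t)⁻¹) (star x * x), ?_⟩
  set k := cfc (fun t : ℝ => ε ^ 2 * (ε ^ 2 + t)⁻¹) (star x * x) with hk
  have hb : cfc (fun t : ℝ => (ε ^ 2 + t)⁻¹) (star x * x) * (star x * x) = 1 - k := by
    rw [eq_sub_iff_add_eq]
    nth_rewrite 2 [← cfc_id' ℝ (star x * x)]
    rw [← cfc_mul _ _ _ hc hid, hk,
      ← cfc_add _ _ _ (hc.fun_mul hid) hc', ← cfc_one ℝ (star x * x)]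
    refine cfc_congr fun t ht => ?_
    have := hne t ht
    simp only [Pi.one_apply]
    field_simp
    ring
  have hks : star k = k := (cfc_predicate _ _ : IsSelfAdjoint k)
  have hkk : k * (star x * x) * k
      = cfc (fun t : ℝ => ε ^ 2 * (ε ^ 2 + t)⁻¹ * t * (ε ^ 2 * (ε ^ 2 + t)⁻¹)) (star x * x) := by
    rw [cfc_mul _ _ _ (hc'.fun_mul hid) hc', cfc_mul _ _ _ hc' hid,
      cfc_id' ℝ (star x * x)]
  -- `x - x * (1 - k) = x * k`, so the C*-identity reduces the claim to a bound on
  -- `k * (star x * x) * k`.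
  have hnorm : ‖k * (star x * x) * k‖ ≤ ε ^ 2 := by
    rw [hkk]
    refine norm_cfc_le hδ.le fun t ht => ?_
    have h0 := hnn t ht
    rw [Real.norm_of_nonneg (by positivity)]
    have : ε ^ 2 * (ε ^ 2 + t)⁻¹ * t * (ε ^ 2 * (ε ^ 2 + t)⁻¹)
        = ε ^ 2 * ((ε ^ 2 * t) / (ε ^ 2 + t) ^ 2) := by
      have := hne t ht
      field_simp
    rw [this]
    refine mul_le_of_le_one_right hδ.le ((div_le_one (by positivity)).mpr ?_)
    nlinarith [sq_nonneg t, sq_nonneg (ε ^ 2), mul_nonneg hδ.le h0]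
  rw [hb, mul_sub, mul_one, sub_sub_cancel]
  refine le_of_sq_le_sq ?_ hε.le
  rw [sq, ← CStarRing.norm_star_mul_self, star_mul, hks]
  simpa only [mul_assoc] using hnorm

namespace MaxA

/-- A closed subspace that contains all `x * (b * (star x * x))` contains `x`. -/
theorem mem_of_forall_mul_star_mul_self_mem {P : MaxA A} {x : A}
    (h : ∀ b, x * (b * (star x * x)) ∈ P) : x ∈ P := by
  have hP : IsClosed (P : Set A) := ClosedSubmodule.isClosed P
  suffices x ∈ closure (P : Set A) by rwa [hP.closure_eq] at this
  refine Metric.mem_closure_iff.mpr fun ε hε => ?_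
  obtain ⟨b, hb⟩ := exists_norm_sub_mul_star_mul_self_le x (half_pos hε)
  exact ⟨_, h b, by rw [dist_eq_norm]; linarith⟩

theorem mul_mem_mul {P Q : MaxA A} {x y : A} (hx : x ∈ P) (hy : y ∈ Q) : x * y ∈ P * Q :=
  mul_le.mp le_rfl x hx y hy

theorem mem_left_iff {M : MaxA A} : M ∈ (closedLeftIdeals A).carrier ↔ ⊤ * M = M := by
  refine ⟨fun h => le_antisymm (mul_le.mpr fun a _ x hx => h a x hx) fun x hx => ?_,
    fun h a x hx => h ▸ mul_mem_mul ClosedSubmodule.mem_top hx⟩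
  rw [← one_mul x]
  exact mul_mem_mul ClosedSubmodule.mem_top hx

theorem mem_right_iff {N : MaxA A} : N ∈ (closedRightIdeals A).carrier ↔ N * ⊤ = N := by
  refine ⟨fun h => le_antisymm (mul_le.mpr fun x hx a _ => h a x hx) fun x hx => ?_,
    fun h a x hx => h ▸ mul_mem_mul hx ClosedSubmodule.mem_top⟩
  rw [← mul_one x]
  exact mul_mem_mul hx ClosedSubmodule.mem_top

theorem top_mul_top : (⊤ : MaxA A) * ⊤ = ⊤ := isBalanced_maxA A

theorem top_mul_top_mul (P : MaxA A) : ⊤ * (⊤ * P) = ⊤ * P := by rw [← mul_assoc, top_mul_top]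

/-- A closed left ideal is idempotent. -/
theorem left_mul_self {M : MaxA A} (hM : M ∈ (closedLeftIdeals A).carrier) : M * M = M :=
  le_antisymm (mul_le.mpr fun a _ x hx => hM a x hx) fun _ hx =>
    mem_of_forall_mul_star_mul_self_mem fun _ => mul_mem_mul hx (hM _ _ (hM _ _ hx))

/-- A closed two-sided ideal is self-adjoint. -/
theorem adj_eq_self {I : MaxA A} (hI : I ∈ (closedIdeals A).carrier) : I.adj = I := by
  have key : I ≤ I.adj := fun x hx => by
    refine mem_of_forall_mul_star_mul_self_mem fun b => ?_
    rw [mem_adj, star_mul, star_mul, star_mul, star_star]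
    exact hI.2 _ _ (hI.2 _ _ (hI.1 _ _ hx))
  exact le_antisymm (adj_le_iff.mpr key) key

/-- The multiplication of closed two-sided ideals is commutative: the product `I * J` lies in
both factors and is idempotent. -/
theorem mul_comm_of_mem {I J : MaxA A} (hI : I ∈ (closedIdeals A).carrier)
    (hJ : J ∈ (closedIdeals A).carrier) : I * J = J * I := by
  have key : ∀ {I J : MaxA A}, I ∈ (closedIdeals A).carrier → J ∈ (closedIdeals A).carrier →
      I * J ≤ J * I := fun {I J} hI hJ => by
    rw [← left_mul_self ((closedIdeals A).mul_mem' I hI J hJ).1]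
    exact mul_le_mul' (mul_le.mpr fun a _ _ hx => hJ.1 a _ hx)
      (mul_le.mpr fun _ hx a _ => hI.2 a _ hx)
  exact le_antisymm (key hI hJ) (key hJ hI)

end MaxA

/-- The closed two-sided ideal generated by a closed subspace. -/
def idealSpan (P : MaxA A) : closedIdeals A :=
  ⟨⊤ * P * ⊤, MaxA.mem_left_iff.mpr (by rw [← mul_assoc, ← mul_assoc, MaxA.top_mul_top]),
    MaxA.mem_right_iff.mpr (by rw [mul_assoc, MaxA.top_mul_top])⟩

namespace MaxA

/-- The two-sided ideals generated by two closed subspaces commute. -/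
theorem span_mul_span_comm (P Q : MaxA A) :
    ⊤ * P * ⊤ * (⊤ * Q * ⊤) = ⊤ * Q * ⊤ * (⊤ * P * ⊤) :=
  mul_comm_of_mem (idealSpan P).2 (idealSpan Q).2

/-- Middle factors commute when `⊤` separates all factors, since `⊤ * Q * ⊤` and `⊤ * R * ⊤` are
two-sided ideals. This is the source of bisymmetry. -/
theorem mul_top_mul_comm (P Q R S : MaxA A) :
    P * ⊤ * Q * ⊤ * R * ⊤ * S = P * ⊤ * R * ⊤ * Q * ⊤ * S := by
  have h := congrArg (fun Z => P * Z * S) (span_mul_span_comm Q R)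
  simp only [mul_assoc, top_mul_top_mul] at h ⊢
  exact h

end MaxA

theorem coe_top_left : (⊤ : closedLeftIdeals A).1 = ⊤ :=
  Subquantale.coe_top_of_mem _ fun _ _ _ => ClosedSubmodule.mem_top

theorem coe_top_right : (⊤ : closedRightIdeals A).1 = ⊤ :=
  Subquantale.coe_top_of_mem _ fun _ _ _ => ClosedSubmodule.mem_top

theorem left_eq (M : closedLeftIdeals A) : ⊤ * M.1 = M.1 := MaxA.mem_left_iff.mp M.2

theorem right_eq (N : closedRightIdeals A) : N.1 * ⊤ = N.1 := MaxA.mem_right_iff.mp N.2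

theorem isBisymmetric_closedLeftIdeals : IsBisymmetric (closedLeftIdeals A) :=
  fun a b c d => Subquantale.Elem.ext (by
    change a.1 * b.1 * c.1 * d.1 = a.1 * c.1 * b.1 * d.1
    rw [← left_eq b, ← left_eq c, ← left_eq d]
    simpa only [mul_assoc, MaxA.top_mul_top_mul] using MaxA.mul_top_mul_comm a.1 b.1 c.1 d.1)

theorem isBisymmetric_closedRightIdeals : IsBisymmetric (closedRightIdeals A) :=
  fun a b c d => Subquantale.Elem.ext (by
    change a.1 * b.1 * c.1 * d.1 = a.1 * c.1 * b.1 * d.1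
    rw [← right_eq a, ← right_eq b, ← right_eq c]
    simpa only [mul_assoc] using MaxA.mul_top_mul_comm a.1 b.1 c.1 d.1)

theorem idealSpan_left (M : closedLeftIdeals A) : toLeftIdeals A (idealSpan M.1) = M * ⊤ :=
  Subquantale.Elem.ext (by
    change ⊤ * M.1 * ⊤ = M.1 * (⊤ : closedLeftIdeals A).1
    rw [left_eq, coe_top_left])

theorem idealSpan_right (N : closedRightIdeals A) : toRightIdeals A (idealSpan N.1) = ⊤ * N :=
  Subquantale.Elem.ext (by
    change ⊤ * N.1 * ⊤ = (⊤ : closedRightIdeals A).1 * N.1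
    rw [mul_assoc, right_eq, coe_top_right])

theorem top_mul_left (M : closedLeftIdeals A) : ⊤ * M = M :=
  Subquantale.Elem.ext (by
    change (⊤ : closedLeftIdeals A).1 * M.1 = M.1
    rw [coe_top_left, left_eq])

theorem right_mul_top (N : closedRightIdeals A) : N * ⊤ = N :=
  Subquantale.Elem.ext (by
    change N.1 * (⊤ : closedRightIdeals A).1 = N.1
    rw [coe_top_right, right_eq])

theorem leftIdeal_mul_self (M : closedLeftIdeals A) : M * M = M :=
  Subquantale.Elem.ext (MaxA.left_mul_self M.2)

theorem leftAdj_toLeftIdeals (I : closedIdeals A) :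
    leftAdj (toLeftIdeals A I) = toRightIdeals A I :=
  Subquantale.Elem.ext (MaxA.adj_eq_self I.2)

theorem closedIdeals_mul_comm (I J : closedIdeals A) : I * J = J * I :=
  Subquantale.Elem.ext (MaxA.mul_comm_of_mem I.2 J.2)

/-- The product of closed two-sided ideals is their intersection. -/
theorem closedIdeals_mul_eq_inf (I J : closedIdeals A) : I * J = I ⊓ J := by
  have h1 : I * J ≤ I := MaxA.mul_le.mpr fun x hx a _ => I.2.2 a x hx
  have h2 : I * J ≤ J := MaxA.mul_le.mpr fun a _ x hx => J.2.1 a x hx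
  refine le_antisymm (le_inf h1 h2) ?_
  have h3 : (I ⊓ J) * (I ⊓ J) = I ⊓ J := Subquantale.Elem.ext (MaxA.left_mul_self (I ⊓ J).2.1)
  rw [← h3]
  exact mul_le_mul' inf_le_left inf_le_right

end Ideals

/-! ### Generators, bisymmetry and involution of the spectrum -/

section Spectrum

variable {A : Type u} [CStarAlgebra A]

/-- The elementary tensors `π (M ⊗ N)` generate the spectrum under joins. -/
@[elab_as_elim]
theorem spec_induction {P : Spec A → Prop} (hs : ∀ s, (∀ x ∈ s, P x) → P (sSup s))
    (ht : ∀ M N, P (specProj A (Tensor.tmul M N))) (x : Spec A) : P x := by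
  rw [← coeqProj_val x, Tensor.eq_sSup_tmul x.val, (coeqProj _ _).map_sSup']
  refine hs _ ?_
  rintro _ ⟨_, ⟨p, -, rfl⟩, rfl⟩
  exact ht p.1 p.2

theorem specProj_tmul_mul (M M' : closedLeftIdeals A) (N N' : closedRightIdeals A) :
    specProj A (Tensor.tmul M N) * specProj A (Tensor.tmul M' N')
      = specProj A (Tensor.tmul (M * M') (N * N')) := by
  rw [← Tensor.tmul_mul_tmul, (specProj A).map_mul']

theorem specProj_mono {M M' : closedLeftIdeals A} {N N' : closedRightIdeals A} (hM : M ≤ M')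
    (hN : N ≤ N') : specProj A (Tensor.tmul M N) ≤ specProj A (Tensor.tmul M' N') :=
  (specProj A).monotone (Tensor.tmul_le.mpr
    ((Tensor.tmul M' N').lower' (M, N) (M', N') ⟨hM, hN⟩ (Tensor.tmul_le.mp le_rfl)))

theorem spec_top : (⊤ : Spec A) = specProj A (Tensor.tmul ⊤ ⊤) := by
  rw [← Tensor.top_eq_tmul]
  refine (top_le_iff.mp ?_).symm
  rw [← coeqProj_val (⊤ : Spec A)]
  exact (specProj A).monotone le_top

theorem specProj_ideal (I : closedIdeals A) :
    specProj A (Tensor.tmul (toLeftIdeals A I) ⊤)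
      = specProj A (Tensor.tmul ⊤ (toRightIdeals A I)) :=
  coeqProj_condition (idealInl A) (idealInr A) I

/-- Every elementary tensor of the spectrum is a product of a right-sided and a left-sided
element. -/
theorem specProj_tmul_eq_mul (M : closedLeftIdeals A) (N : closedRightIdeals A) :
    specProj A (Tensor.tmul M N)
      = specProj A (Tensor.tmul ⊤ N) * specProj A (Tensor.tmul M ⊤) := by
  rw [specProj_tmul_mul, top_mul_left, right_mul_top]

theorem isBisymmetric_spec : IsBisymmetric (Spec A) := by
  intro a b c d
  induction a using spec_induction with
  | hs s h =>
    simp only [sSup_mul_distrib, biSup_mul_distrib]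
    exact iSup_congr fun x => iSup_congr fun hx => h x hx
  | ht M₁ N₁ =>
  induction b using spec_induction with
  | hs s h =>
    simp only [mul_sSup_distrib, biSup_mul_distrib]
    exact iSup_congr fun x => iSup_congr fun hx => h x hx
  | ht M₂ N₂ =>
  induction c using spec_induction with
  | hs s h =>
    simp only [mul_sSup_distrib, biSup_mul_distrib]
    exact iSup_congr fun x => iSup_congr fun hx => h x hx
  | ht M₃ N₃ =>
  induction d using spec_induction with
  | hs s h =>
    simp only [mul_sSup_distrib]
    exact iSup_congr fun x => iSup_congr fun hx => h x hx
  | ht M₄ N₄ =>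
  simp only [specProj_tmul_mul]
  rw [isBisymmetric_closedLeftIdeals M₁, isBisymmetric_closedRightIdeals N₁]

theorem isSemiUnital_spec : IsSemiUnital (Spec A) := by
  have hone : ∀ P : MaxA A, P ≤ ⊤ * P ∧ P ≤ P * ⊤ := fun P =>
    ⟨fun x hx => one_mul x ▸ MaxA.mul_mem_mul ClosedSubmodule.mem_top hx,
      fun x hx => mul_one x ▸ MaxA.mul_mem_mul hx ClosedSubmodule.mem_top⟩
  intro a
  induction a using spec_induction with
  | hs s h =>
    exact ⟨sSup_le fun x hx => (h x hx).1.trans (mul_le_mul_right (le_sSup hx) ⊤),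
      sSup_le fun x hx => (h x hx).2.trans (mul_le_mul_left (le_sSup hx) ⊤)⟩
  | ht M N =>
    rw [spec_top, specProj_tmul_mul, specProj_tmul_mul, top_mul_left, right_mul_top]
    refine ⟨specProj_mono le_rfl ?_, specProj_mono ?_ le_rfl⟩
    · change N.1 ≤ (⊤ : closedRightIdeals A).1 * N.1
      rw [coe_top_right]
      exact (hone N.1).1
    · change M.1 ≤ M.1 * (⊤ : closedLeftIdeals A).1
      rw [coe_top_left]
      exact (hone M.1).2

theorem tensorAdj_mono : Monotone (tensorAdj (A := A)) :=
  OrderHomClass.mono (tensorInvolution (A := A)).tosSupHom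

theorem tensorAdj_idealInl (I : closedIdeals A) : tensorAdj (idealInl A I) = idealInr A I := by
  have h : rightAdj (⊤ : closedRightIdeals A) = ⊤ := adjIso.symm.map_top
  change tensorAdj (Tensor.tmul _ _) = Tensor.tmul _ _
  rw [tensorAdj_tmul, h, leftAdj_toLeftIdeals]

theorem tensorAdj_idealInr (I : closedIdeals A) : tensorAdj (idealInr A I) = idealInl A I := by
  rw [← tensorAdj_idealInl, tensorAdj_tensorAdj]

/-- The conjugate by the involution of a nucleus on the tensor product. -/
def conjNucleus (c : QuanticNucleus (IdealTensor A)) : QuanticNucleus (IdealTensor A) where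
  toClosureOperator := ClosureOperator.mk' (fun U => tensorAdj (c.toClosureOperator (tensorAdj U)))
    (fun _ _ h => tensorAdj_mono (c.monotone (tensorAdj_mono h)))
    (fun U => tensorAdj_le_iff.mp (c.le_closure _))
    (fun U => by rw [tensorAdj_tensorAdj, c.idempotent])
  mul_le' U V := by
    change tensorAdj _ * tensorAdj _ ≤ tensorAdj (c.toClosureOperator (tensorAdj _))
    rw [← tensorAdj_mul, tensorAdj_mul U V]
    exact tensorAdj_mono (c.mul_le' _ _)

/-- The nucleus that defines the spectrum commutes with the involution of the tensor product,
since its conjugate also identifies `I ⊗ ⊤` with `⊤ ⊗ I`. -/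
theorem coeqNucleus_tensorAdj (U : IdealTensor A) :
    (coeqNucleus (idealInl A) (idealInr A)).toClosureOperator (tensorAdj U)
      = tensorAdj ((coeqNucleus (idealInl A) (idealInr A)).toClosureOperator U) := by
  set c := coeqNucleus (idealInl A) (idealInr A)
  have key : ∀ U, c.toClosureOperator U ≤ tensorAdj (c.toClosureOperator (tensorAdj U)) :=
    coeqNucleus_le (c := conjNucleus c) fun I => by
      change tensorAdj (c.toClosureOperator (tensorAdj _))
        = tensorAdj (c.toClosureOperator (tensorAdj _))
      rw [tensorAdj_idealInl, tensorAdj_idealInr]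
      exact congrArg (fun x => tensorAdj (QuanticNucleus.Quotient.val x))
        (coeqProj_condition (idealInl A) (idealInr A) I).symm
  refine le_antisymm ?_ (tensorAdj_le_iff.mpr (key U))
  have := key (tensorAdj U)
  rwa [tensorAdj_tensorAdj] at this

theorem specProj_tensorAdj_val (U : IdealTensor A) :
    specProj A (tensorAdj (specProj A U).val) = specProj A (tensorAdj U) :=
  QuanticNucleus.Quotient.ext (by
    change (coeqNucleus _ _).toClosureOperator (tensorAdj ((coeqNucleus _ _).toClosureOperator _))
      = (coeqNucleus _ _).toClosureOperator _
    rw [← coeqNucleus_tensorAdj, (coeqNucleus _ _).idempotent])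

variable (A) in
/-- The involution of the spectrum, induced by that of the tensor product. -/
def specInvolution : Involution (Spec A) where
  toFun x := specProj A (tensorAdj x.val)
  map_sSup' s := by
    change specProj A (tensorAdj (specProj A (sSup _)).val) = _
    rw [specProj_tensorAdj_val, show tensorAdj _ = _ from tensorInvolution.map_sSup' _,
      (specProj A).map_sSup', Set.image_image, Set.image_image]
    rfl
  map_mul' x y := by
    change specProj A (tensorAdj (specProj A (x.val * y.val)).val) = _
    rw [specProj_tensorAdj_val, tensorAdj_mul, (specProj A).map_mul']
  involutive' x := by
    rw [specProj_tensorAdj_val, tensorAdj_tensorAdj]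
    exact coeqProj_val x

theorem specInvolution_specProj (U : IdealTensor A) :
    specInvolution A (specProj A U) = specProj A (tensorAdj U) :=
  specProj_tensorAdj_val U

/-! ### Left-sided and two-sided elements of the spectrum -/

variable (A) in
/-- The homomorphism from the spectrum to closed left ideals that sends `π (M ⊗ N)` to
`A * N * A * M`. It is a retraction of `M ↦ π (M ⊗ ⊤)`. -/
def specRetract : QuantaleHom (Spec A) (closedLeftIdeals A) :=
  coeqDesc
    (Tensor.lift (fun M N => toLeftIdeals A (idealSpan N.1) * M)
      (fun s N => by rw [mul_sSup_distrib, sSup_image])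
      (fun M t => Subquantale.Elem.ext (by
        rw [Subquantale.coe_sSup (closedLeftIdeals A), Set.image_image, sSup_image]
        change ⊤ * sSup (Subquantale.Elem.val '' t) * ⊤ * M.1 = ⨆ N ∈ t, ⊤ * N.1 * ⊤ * M.1
        rw [sSup_image]
        simp only [mul_biSup_distrib, biSup_mul_distrib]))
      (fun M N M' N' => Subquantale.Elem.ext (by
        change ⊤ * (N.1 * N'.1) * ⊤ * (M.1 * M'.1) = ⊤ * N.1 * ⊤ * M.1 * (⊤ * N'.1 * ⊤ * M'.1)
        -- Absorbed factors `⊤` are inserted until `N'` and `M` are separated and commute.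
        rw [← right_eq N, ← left_eq M, ← left_eq M']
        have h := MaxA.mul_top_mul_comm (⊤ * N.1) N'.1 M.1 M'.1
        simp only [mul_assoc, MaxA.top_mul_top_mul] at h ⊢
        exact h)))
    (fun I => by
      change Tensor.lift _ _ _ _ (Tensor.tmul _ _) = Tensor.lift _ _ _ _ (Tensor.tmul _ _)
      rw [Tensor.lift_tmul, Tensor.lift_tmul]
      refine Subquantale.Elem.ext ?_
      change ⊤ * (⊤ : closedRightIdeals A).1 * ⊤ * I.1
        = ⊤ * I.1 * ⊤ * (⊤ : closedLeftIdeals A).1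
      rw [coe_top_left, coe_top_right, MaxA.top_mul_top, MaxA.top_mul_top,
        MaxA.mem_left_iff.mp I.2.1, MaxA.mem_right_iff.mp I.2.2, MaxA.mem_right_iff.mp I.2.2])

theorem specRetract_tmul (M : closedLeftIdeals A) (N : closedRightIdeals A) :
    specRetract A (specProj A (Tensor.tmul M N)) = toLeftIdeals A (idealSpan N.1) * M :=
  (coeqDesc_coeqProj _ _ _).trans (Tensor.lift_tmul _ _ _ _ M N)

theorem specRetract_tmul_top (M : closedLeftIdeals A) :
    specRetract A (specProj A (Tensor.tmul M ⊤)) = M := by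
  refine (specRetract_tmul M ⊤).trans (Subquantale.Elem.ext ?_)
  change ⊤ * (⊤ : closedRightIdeals A).1 * ⊤ * M.1 = M.1
  rw [coe_top_right, MaxA.top_mul_top, MaxA.top_mul_top, left_eq]

/-- Multiplication by `⊤` from the left turns every element of the spectrum into one of the form
`π (M ⊗ ⊤)`: for a two-sided ideal `J` one has
`M ⊗ J = (⊤ ⊗ J) * (M ⊗ ⊤) ~ (J ⊗ ⊤) * (M ⊗ ⊤) = (J * M) ⊗ ⊤`. -/
theorem top_mul_spec (x : Spec A) :
    ⊤ * x = specProj A (Tensor.tmul (specRetract A x) ⊤) := by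
  induction x using spec_induction with
  | hs s h =>
    rw [mul_sSup_distrib, (specRetract A).map_sSup', Tensor.tmul_sSup_left,
      (specProj A).map_sSup', Set.image_image, Set.image_image, sSup_image]
    exact iSup_congr fun x => iSup_congr fun hx => h x hx
  | ht M N =>
    rw [specRetract_tmul, spec_top, specProj_tmul_mul, top_mul_left, ← idealSpan_right,
      specProj_tmul_eq_mul, ← specProj_ideal, specProj_tmul_mul, right_mul_top]

theorem isLeftSided_specProj (M : closedLeftIdeals A) :
    IsLeftSided (specProj A (Tensor.tmul M ⊤)) := by
  change ⊤ * _ ≤ _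
  rw [top_mul_spec, specRetract_tmul_top]

theorem isRightSided_specProj (N : closedRightIdeals A) :
    IsRightSided (specProj A (Tensor.tmul ⊤ N)) := by
  change _ * ⊤ ≤ _
  rw [spec_top, specProj_tmul_mul, top_mul_left, right_mul_top]

theorem eq_specProj_of_isLeftSided {x : Spec A} (hx : IsLeftSided x) :
    specProj A (Tensor.tmul (specRetract A x) ⊤) = x := by
  rw [← top_mul_spec]
  exact le_antisymm hx (isSemiUnital_spec x).1

variable (A) in
/-- The homomorphism `M ↦ π (M ⊗ ⊤)` from closed left ideals to left-sided elements. -/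
def specLeft : QuantaleHom (closedLeftIdeals A) (leftPart (Spec A)) where
  toFun M := ⟨specProj A (Tensor.tmul M ⊤), isLeftSided_specProj M⟩
  map_sSup' s := Subquantale.Elem.ext (by
    rw [Subquantale.coe_sSup, Set.image_image]
    change specProj A _ = _
    rw [Tensor.tmul_sSup_left, (specProj A).map_sSup', Set.image_image])
  map_mul' M N := Subquantale.Elem.ext (by
    change specProj A _ = specProj A _ * specProj A _
    rw [specProj_tmul_mul, right_mul_top])

variable (A) in
/-- The homomorphism `N ↦ π (⊤ ⊗ N)` from closed right ideals to right-sided elements. -/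
def specRight : QuantaleHom (closedRightIdeals A) (rightPart (Spec A)) where
  toFun N := ⟨specProj A (Tensor.tmul ⊤ N), isRightSided_specProj N⟩
  map_sSup' s := Subquantale.Elem.ext (by
    rw [Subquantale.coe_sSup, Set.image_image]
    change specProj A _ = _
    rw [Tensor.tmul_sSup_right, (specProj A).map_sSup', Set.image_image])
  map_mul' M N := Subquantale.Elem.ext (by
    change specProj A _ = specProj A _ * specProj A _
    rw [specProj_tmul_mul, top_mul_left])

variable (A) in
/-- The isomorphism `M ↦ π (M ⊗ ⊤)` from closed left ideals onto left-sided elements. -/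
def leftIdealIso : closedLeftIdeals A ≃o leftPart (Spec A) where
  toFun := specLeft A
  invFun x := specRetract A x.1
  left_inv := specRetract_tmul_top
  right_inv x := Subquantale.Elem.ext (eq_specProj_of_isLeftSided x.2)
  map_rel_iff' {M N} := by
    refine ⟨fun h => ?_, fun h => specProj_mono h le_rfl⟩
    rw [← specRetract_tmul_top M, ← specRetract_tmul_top N]
    exact (specRetract A).monotone h

theorem isTwoSided_specProj (I : closedIdeals A) :
    specProj A (Tensor.tmul (toLeftIdeals A I) ⊤) ∈ (twoSidedPart (Spec A)).carrier :=
  ⟨isLeftSided_specProj _, specProj_ideal I ▸ isRightSided_specProj _⟩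

theorem exists_eq_specProj_of_twoSided {x : Spec A} (hl : IsLeftSided x) (hr : IsRightSided x) :
    ∃ I : closedIdeals A, x = specProj A (Tensor.tmul (toLeftIdeals A I) ⊤) := by
  refine ⟨idealSpan (specRetract A x).1, ?_⟩
  calc x = x * ⊤ := le_antisymm (isSemiUnital_spec x).2 hr
    _ = _ := by
      nth_rewrite 1 [← eq_specProj_of_isLeftSided hl]
      rw [spec_top, specProj_tmul_mul, right_mul_top, idealSpan_left]

theorem mul_self_of_isLeftSided {x : Spec A} (hx : IsLeftSided x) : x * x = x := by
  rw [← eq_specProj_of_isLeftSided hx, specProj_tmul_mul, leftIdeal_mul_self, right_mul_top]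

theorem isLeftSided_specInvolution {x : Spec A} (hx : IsRightSided x) :
    IsLeftSided (specInvolution A x) := by
  have hmono : Monotone (specInvolution A) := OrderHomClass.mono (specInvolution A).tosSupHom
  have htop : specInvolution A ⊤ = ⊤ := top_le_iff.mp (by
    conv_lhs => rw [← (specInvolution A).involutive' ⊤]
    exact hmono le_top)
  change ⊤ * _ ≤ _
  rw [← htop, ← (specInvolution A).map_mul']
  exact hmono hx

theorem mul_self_of_isRightSided {x : Spec A} (hx : IsRightSided x) : x * x = x := by
  rw [← (specInvolution A).involutive' x, ← (specInvolution A).map_mul',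
    mul_self_of_isLeftSided (isLeftSided_specInvolution hx)]

theorem specInvolution_specProj_ideal (I : closedIdeals A) :
    specInvolution A (specProj A (Tensor.tmul (toLeftIdeals A I) ⊤))
      = specProj A (Tensor.tmul (toLeftIdeals A I) ⊤) := by
  rw [specInvolution_specProj]
  exact (congrArg _ (tensorAdj_idealInl I)).trans (specProj_ideal I).symm

theorem twoSidedPart_spec_mul_comm (x y : twoSidedPart (Spec A)) : x * y = y * x := by
  refine Subquantale.Elem.ext ?_
  obtain ⟨I, hI⟩ := exists_eq_specProj_of_twoSided x.2.1 x.2.2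
  obtain ⟨J, hJ⟩ := exists_eq_specProj_of_twoSided y.2.1 y.2.2
  rw [Subquantale.coe_mul, Subquantale.coe_mul, hI, hJ, specProj_tmul_mul, specProj_tmul_mul]
  exact congrArg (fun K => specProj A (Tensor.tmul K (⊤ * ⊤)))
    (congrArg (toLeftIdeals A) (closedIdeals_mul_comm I J))

/-! ### The universal properties of the spectrum -/

variable (A) in
/-- The projection onto the spectrum is a coequalizer in the category of quantales. -/
def isColimitSpec : Limits.IsColimit
    (Limits.Cofork.ofπ (quantSpecProj A) (quantSpecProj_condition A)) :=
  Limits.Cofork.IsColimit.mk' _ fun s =>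
    have hs : ∀ I, s.π.toFun (idealInl A I) = s.π.toFun (idealInr A I) := fun I =>
      congrArg (fun k : QuantaleHom _ _ => k I) s.condition
    ⟨coeqDesc (f := idealInl A) (g := idealInr A) s.π hs,
      QuantaleHom.ext (funext fun U => coeqDesc_coeqProj _ hs U),
      fun {m} hm => QuantaleHom.ext (funext fun x => by
        refine (congrArg m.toFun (coeqProj_val x)).symm.trans ?_
        exact congrArg (fun k : QuantaleHom _ _ => k x.val) hm)⟩

theorem toLeftIdeals_top : toLeftIdeals A ⊤ = ⊤ :=
  Subquantale.Elem.ext ((Subquantale.coe_top_of_mem (closedIdeals A)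
    ⟨fun _ _ _ => ClosedSubmodule.mem_top, fun _ _ _ => ClosedSubmodule.mem_top⟩).trans
      coe_top_left.symm)

theorem toRightIdeals_top : toRightIdeals A ⊤ = ⊤ :=
  Subquantale.Elem.ext ((congrArg Subquantale.Elem.val (toLeftIdeals_top (A := A))).trans
    (coe_top_left.trans coe_top_right.symm))

/-- The homomorphism out of the spectrum that is induced by homomorphisms `g` on closed left and
`h` on closed right ideals which agree on two-sided ideals: it sends `π (M ⊗ N)` to
`h N * g M`, and bisymmetry makes it multiplicative. -/
def specDesc {T : Type u} [CompleteLattice T] [Semigroup T] [IsQuantale T] (hT : IsBisymmetric T)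
    (g : QuantaleHom (closedLeftIdeals A) T) (h : QuantaleHom (closedRightIdeals A) T)
    (hgh : ∀ I, g (toLeftIdeals A I) = h (toRightIdeals A I)) : QuantaleHom (Spec A) T :=
  coeqDesc
    (Tensor.lift (fun M N => h N * g M)
      (fun s N => by rw [g.map_sSup', mul_sSup_distrib, iSup_image, sSup_image])
      (fun M t => by rw [h.map_sSup', sSup_mul_distrib, iSup_image, sSup_image])
      (fun M N M' N' => by
        rw [g.map_mul', h.map_mul', ← mul_assoc, ← mul_assoc]
        exact hT _ _ _ _))
    (fun I => by
      change Tensor.lift _ _ _ _ (Tensor.tmul _ _) = Tensor.lift _ _ _ _ (Tensor.tmul _ _)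
      -- `h ⊤ = g ⊤` can be moved into either factor, where the ideal absorbs it.
      have htop : h ⊤ = g ⊤ := by rw [← toLeftIdeals_top, hgh, toRightIdeals_top]
      rw [Tensor.lift_tmul, Tensor.lift_tmul, htop, ← g.map_mul', top_mul_left, ← htop,
        ← h.map_mul', right_mul_top, hgh])

theorem specDesc_tmul {T : Type u} [CompleteLattice T] [Semigroup T] [IsQuantale T]
    (hT : IsBisymmetric T) (g : QuantaleHom (closedLeftIdeals A) T)
    (h : QuantaleHom (closedRightIdeals A) T)
    (hgh : ∀ I, g (toLeftIdeals A I) = h (toRightIdeals A I)) (M : closedLeftIdeals A)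
    (N : closedRightIdeals A) :
    specDesc hT g h hgh (specProj A (Tensor.tmul M N)) = h N * g M :=
  (coeqDesc_coeqProj _ _ _).trans (Tensor.lift_tmul _ _ _ _ M N)

theorem exists_specProj_eq_of_isRightSided {x : Spec A} (hx : IsRightSided x) :
    ∃ N : closedRightIdeals A, specProj A (Tensor.tmul ⊤ N) = x := by
  have hl : IsLeftSided (specInvolution A x) := isLeftSided_specInvolution hx
  refine ⟨leftAdj (specRetract A (specInvolution A x)), ?_⟩
  have h := congrArg (specInvolution A) (eq_specProj_of_isLeftSided hl)
  rw [(specInvolution A).involutive', specInvolution_specProj, tensorAdj_tmul] at h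
  rwa [show rightAdj (⊤ : closedRightIdeals A) = ⊤ from adjIso.symm.map_top] at h

section Pushout

variable {T : Type u} [CompleteLattice T] [Semigroup T]

/-- A strong homomorphism out of the spectrum is determined by its values on left-sided and on
right-sided elements. -/
theorem strongHom_ext {k m : StrongHom (Spec A) T}
    (hl : ∀ x : leftPart (Spec A), k.toFun x.1 = m.toFun x.1)
    (hr : ∀ x : rightPart (Spec A), k.toFun x.1 = m.toFun x.1) : k = m :=
  StrongHom.ext (funext fun x => by
    induction x using spec_induction with
    | hs t ht => rw [k.map_sSup', m.map_sSup', Set.image_congr ht]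
    | ht M N =>
      rw [specProj_tmul_eq_mul, k.map_mul', m.map_mul']
      exact congrArg₂ (· * ·) (hr (specRight A N)) (hl (specLeft A M)))

/-- Strong homomorphisms to a balanced and bisymmetric quantale, on the left-sided and on the
right-sided elements of the spectrum, have a common extension if they agree on the two-sided
elements. -/
theorem exists_strongHom_of_agree [IsQuantale T] (hb : IsBalanced T) (hT : IsBisymmetric T)
    (g : StrongHom (leftPart (Spec A)) T) (h : StrongHom (rightPart (Spec A)) T)
    (hgh : ∀ (x : Spec A) (hl : IsLeftSided x) (hr : IsRightSided x),
      g.toFun ⟨x, hl⟩ = h.toFun ⟨x, hr⟩) :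
    ∃ k : StrongHom (Spec A) T, (∀ x : leftPart (Spec A), k.toFun x.1 = g.toFun x) ∧
      ∀ x : rightPart (Spec A), k.toFun x.1 = h.toFun x := by
  set g' := g.toQuantaleHom.comp (specLeft A)
  set h' := h.toQuantaleHom.comp (specRight A)
  have hgh' : ∀ I, g' (toLeftIdeals A I) = h' (toRightIdeals A I) := fun I => by
    refine (hgh _ _ (isTwoSided_specProj I).2).trans ?_
    exact congrArg h.toFun (Subquantale.Elem.ext (specProj_ideal I))
  have hg : g' ⊤ = ⊤ := by
    rw [← g.map_top']
    exact congrArg g.toFun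
      (Subquantale.Elem.ext (spec_top.symm.trans (coe_top_leftPart (Spec A)).symm))
  have hh : h' ⊤ = ⊤ := by
    rw [← toRightIdeals_top, ← hgh', toLeftIdeals_top, hg]
  refine ⟨{ specDesc hT g' h' hgh' with map_top' := ?_ }, fun x => ?_, fun x => ?_⟩
  · rw [spec_top, specDesc_tmul, hg, hh]
    exact hb
  · obtain ⟨M, rfl⟩ := (leftIdealIso A).surjective x
    change specDesc hT g' h' hgh' (specProj A (Tensor.tmul M ⊤)) = g' M
    rw [specDesc_tmul, hh, ← hg, ← g'.map_mul', top_mul_left]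
  · obtain ⟨N, hN⟩ := exists_specProj_eq_of_isRightSided x.2
    obtain rfl : specRight A N = x := Subquantale.Elem.ext hN
    change specDesc hT g' h' hgh' (specProj A (Tensor.tmul ⊤ N)) = h' N
    rw [specDesc_tmul, hg, ← hh, ← h'.map_mul', right_mul_top]

end Pushout

/-- The square of inclusions of the two-sided, left-sided and right-sided elements of the
spectrum is a pushout. -/
theorem isPushout_spec (hb : IsBalanced (Spec A)) (hs : IsBisymmetric (Spec A)) :
    IsPushout (inclTwoSidedLeft hb hs) (inclTwoSidedRight hb hs) (inclLeft hb hs)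
      (inclRight hb hs) := by
  have key : ∀ s : Limits.PushoutCocone (inclTwoSidedLeft hb hs) (inclTwoSidedRight hb hs),
      ∀ (x : Spec A) (hl : IsLeftSided x) (hr : IsRightSided x),
        s.inl.toFun ⟨x, hl⟩ = s.inr.toFun ⟨x, hr⟩ := fun s x hl hr =>
    congrArg (fun k : StrongHom (twoSidedPart (Spec A)) s.pt.carrier => k.toFun ⟨x, hl, hr⟩)
      s.condition
  have ex : ∀ s : Limits.PushoutCocone (inclTwoSidedLeft hb hs) (inclTwoSidedRight hb hs),
      ∃ k : StrongHom (Spec A) s.pt.carrier, (∀ x : leftPart (Spec A), k.toFun x.1 = s.inl.toFun x)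
        ∧ ∀ x : rightPart (Spec A), k.toFun x.1 = s.inr.toFun x := fun s =>
    exists_strongHom_of_agree s.pt.balanced s.pt.bisymmetric s.inl s.inr (key s)
  choose d hdl hdr using ex
  exact IsPushout.of_isColimit' ⟨rfl⟩ (Limits.PushoutCocone.IsColimit.mk _ d
    (fun s => StrongHom.ext (funext (hdl s))) (fun s => StrongHom.ext (funext (hdr s)))
    (fun s m hl hr => strongHom_ext
      (fun x => (congrArg (fun k : StrongHom (leftPart (Spec A)) s.pt.carrier => k.toFun x)
        hl).trans (hdl s x).symm)
      (fun x => (congrArg (fun k : StrongHom (rightPart (Spec A)) s.pt.carrier => k.toFun x)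
        hr).trans (hdr s x).symm)))

theorem isQuanticFrame_spec : IsQuanticFrame (specInvolution A) where
  bisymmetric := isBisymmetric_spec
  semiUnital := isSemiUnital_spec
  idempotent_of_leftSided _ := mul_self_of_isLeftSided
  idempotent_of_rightSided _ := mul_self_of_isRightSided
  hermitian_of_twoSided x hl hr := by
    obtain ⟨I, rfl⟩ := exists_eq_specProj_of_twoSided hl hr
    exact specInvolution_specProj_ideal I
  isPushout := isPushout_spec _ _

/-! ### The commutative case -/

/-- If `A` is commutative, then all closed right ideals are two-sided. -/
theorem exists_toRightIdeals_eq (hA : ∀ a b : A, a * b = b * a) (N : closedRightIdeals A) :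
    ∃ I : closedIdeals A, toRightIdeals A I = N :=
  ⟨⟨N.1, fun a x hx => hA a x ▸ N.2 a x hx, N.2⟩, rfl⟩

/-- If `A` is commutative, then every element of the spectrum is left-sided. -/
theorem isLeftSided_of_comm (hA : ∀ a b : A, a * b = b * a) (x : Spec A) : IsLeftSided x := by
  induction x using spec_induction with
  | hs s h => exact (leftPart (Spec A)).sSup_mem' s h
  | ht M N =>
    obtain ⟨J, rfl⟩ := exists_toRightIdeals_eq hA N
    rw [specProj_tmul_eq_mul, ← specProj_ideal]
    exact (leftPart (Spec A)).mul_mem' _ (isLeftSided_specProj _) _ (isLeftSided_specProj _)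

/-- For commutative `A`, the isomorphism between the spectrum and the closed ideals of `A`. -/
def specIso (hA : ∀ a b : A, a * b = b * a) : Spec A ≃o closedIdeals A where
  toFun x := ⟨(specRetract A x).1, (specRetract A x).2,
    fun a y hy => hA a y ▸ (specRetract A x).2 a y hy⟩
  invFun I := specProj A (Tensor.tmul (toLeftIdeals A I) ⊤)
  left_inv x := eq_specProj_of_isLeftSided (isLeftSided_of_comm hA x)
  right_inv I := Subquantale.Elem.ext (by
    change (specRetract A (specProj A (Tensor.tmul (toLeftIdeals A I) ⊤))).1 = I.1
    rw [specRetract_tmul_top]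
    rfl)
  map_rel_iff' {x y} := by
    refine ⟨fun h => ?_, fun h => (specRetract A).monotone h⟩
    rw [← eq_specProj_of_isLeftSided (isLeftSided_of_comm hA x),
      ← eq_specProj_of_isLeftSided (isLeftSided_of_comm hA y)]
    exact specProj_mono h le_rfl

theorem specIso_mul (hA : ∀ a b : A, a * b = b * a) (x y : Spec A) :
    specIso hA (x * y) = specIso hA x * specIso hA y :=
  Subquantale.Elem.ext (by
    change (specRetract A (x * y)).1 = (specRetract A x).1 * (specRetract A y).1
    rw [(specRetract A).map_mul']
    rfl)

theorem specIso_tmul (hA : ∀ a b : A, a * b = b * a) (I J : closedIdeals A) :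
    specIso hA (specProj A (Tensor.tmul (toLeftIdeals A I) (toRightIdeals A J))) = I * J := by
  rw [closedIdeals_mul_comm]
  refine Subquantale.Elem.ext
    ((congrArg Subquantale.Elem.val (specRetract_tmul _ (toRightIdeals A J))).trans ?_)
  change ⊤ * J.1 * ⊤ * I.1 = J.1 * I.1
  rw [MaxA.mem_left_iff.mp J.2.1, MaxA.mem_right_iff.mp J.2.2]

theorem specInvolution_eq_self_of_comm (hA : ∀ a b : A, a * b = b * a) (x : Spec A) :
    specInvolution A x = x := by
  rw [← (specIso hA).symm_apply_apply x]
  exact specInvolution_specProj_ideal _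

theorem closedIdeals_inf_sSup (I : closedIdeals A) (s : Set (closedIdeals A)) :
    I ⊓ sSup s = ⨆ J ∈ s, I ⊓ J := by
  simp only [← closedIdeals_mul_eq_inf, mul_sSup_distrib]

end Spectrum

end QuanticSpectrum

end

theorem mainTheorem4 (A : Type u) [CStarAlgebra A] :
    -- the projection onto the spectrum is the coequalizer of the two maps in `Quant`
    Nonempty (CategoryTheory.Limits.IsColimit
      (CategoryTheory.Limits.Cofork.ofπ (quantSpecProj A) (quantSpecProj_condition A))) ∧
    -- the spectrum carries an involution that turns the projection into an involutive
    -- homomorphism and the spectrum into a quantic frame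
    ∃ ℓ : Involution (Spec A),
      (∀ t : IdealTensor A, specProj A (tensorInvolution t) = ℓ (specProj A t)) ∧
      IsQuanticFrame ℓ ∧
      -- the two-sided elements of the spectrum form a commutative quantale
      (∀ x y : twoSidedPart (Spec A), x * y = y * x) ∧
      -- `M ↦ π (M ⊗ ⊤)` is an isomorphism from closed left ideals onto left-sided elements
      (∃ e : closedLeftIdeals A ≃o leftPart (Spec A),
        (∀ M N, e (M * N) = e M * e N) ∧
        ∀ M, (e M).val = specProj A (Tensor.tmul M ⊤)) ∧
      -- if `A` is commutative, the spectrum is the frame of closed ideals, with meet as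
      -- multiplication and the identity as involution
      ((∀ a b : A, a * b = b * a) →
        (∀ x : Spec A, ℓ x = x) ∧
        (∀ (I : closedIdeals A) (s : Set (closedIdeals A)), I ⊓ sSup s = ⨆ J ∈ s, I ⊓ J) ∧
        ∃ e : Spec A ≃o closedIdeals A,
          (∀ x y, e (x * y) = e x * e y) ∧
          (∀ x y, e (x * y) = e x ⊓ e y) ∧
          ∀ I J, e (specProj A (Tensor.tmul (toLeftIdeals A I) (toRightIdeals A J))) = I * J) := by
  refine ⟨⟨isColimitSpec A⟩, specInvolution A, fun t => (specInvolution_specProj t).symm,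
    isQuanticFrame_spec, twoSidedPart_spec_mul_comm,
    ⟨leftIdealIso A, (specLeft A).map_mul', fun _ => rfl⟩,
    fun hA => ⟨specInvolution_eq_self_of_comm hA, closedIdeals_inf_sSup, specIso hA,
      specIso_mul hA, fun x y => ?_, specIso_tmul hA⟩⟩
  rw [specIso_mul, closedIdeals_mul_eq_inf]
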